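/- Use units $c=\hbar=k_B=1$ and the metric signature $(-,+,+,+)$. Consider a non-degenerate gas of identical spinless particles of mass $m\ge 0$, described in the rest frame of an inertial observer $\mathcal O$. Write $p^0=\sqrt{m^2+|p|^2}$ and $w^j=p^j/p^0$. Let $f_{\rm eq}(p)=e^{\alpha+\beta_\mu p^\mu}$, with $\beta^\mu$ timelike and future-directed, be a uniform equilibrium state (not necessarily at rest relative to $\mathcal O$), and let $\mathcal H=L^2(\mathbb R^3, f_{\rm eq}\,d^3p/(2\pi)^3)$, with complex-valued elements, inner product $(\cdot,\cdot)$ and norm $\|\cdot\|$. For a measurable differential cross section $\sigma(s,\theta)\ge 0$, the linearized collision operator is $$ (I\psi)(p)=\int\frac{d^3q}{(2\pi)^3}\,f_{\rm eq}(q)\int_{S^2}d\Omega\;\tfrac12\, v_{\text{Møl}}\,\sigma(s,\theta)\,\big[\psi(p)+\psi(q)-\psi(p')-\psi(q')\big], \qquad v_{\text{Møl}}=\frac{\sqrt{(p_\mu q^\mu)^2-m^4}}{p^0q^0}, $$ where $p',q'$ are the outgoing momenta of the elastic collision of $p$ and $q$ with scattering direction $\Omega$ in the center-of-mass frame, $s=-(p+q)_\mu(p+q)^\mu$,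 and $\theta$ is the center-of-mass scattering angle. Its domain consists of those $\psi\in\mathcal H$ for which the same integral with $[\cdots]$ replaced by $|[\cdots]|$ is, as a function of $p$, in $L^2(f_{\rm eq}\,d^3p/(2\pi)^3)$. Assume that this domain is dense in $\mathcal H$, and denote by $I$ also the Friedrichs extension of this operator. A wavevector $k^\mu=(\omega,k^j)\in\mathbb C^4$ is an eigenmode if there are $\psi_n$ in the domain of $I$ with $\|\psi_n\|=1$ and $\|(I-i\omega+i k_jw^j)\psi_n\|\to 0$. For $\psi\in\mathcal H$ let $$\delta J^\mu=\int \frac{d^3p}{(2\pi)^3} f_{\rm eq}\frac{p^\mu}{p^0}\psi ,\qquad \delta T^{\mu\nu}=\int \frac{d^3p}{(2\pi)^3} f_{\rm eq}\frac{p^\mu}{p^0}p^\nu\psi .$$ The non-hydrodynamic spectrum at zero wavenumber relative to an inertial observer with four-velocity $u^\mu$ is the set of all $\omega\in\mathbb C$ such that $k^\mu=\omega u^\mu$ is an eigenmode for which the sequence $\psi_n$ can be chosen so that $u_\mu\delta J^\mu=0$ and $u_\mu\delta T^{\mu\nu}=0$ ($\nu=0,\dots,3$) for every $\psi_n$. (This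 spectrum includes the continuous spectrum.) Theorem. Let $\mathcal O'$ be an inertial observer moving relative to $\mathcal O$ with speed $0\le v<1$, in any direction, and let $\gamma=(1-v^2)^{-1/2}$. Let $0\le a<\infty$ and $b\le\infty$. If the non-hydrodynamic spectrum at $k=0$ relative to $\mathcal O$ is confined to $a\le i\omega\le b$ (in particular $i\omega$ is real), then the non-hydrodynamic spectrum at $k'=0$ relative to $\mathcal O'$ is confined to $$\frac{a(1-v)}{\gamma}\;\le\; i\omega'\;\le\;\frac{b}{\gamma(1-v)}$$ (in particular $i\omega'$ is real; for $b=\infty$ the upper bound is void). -/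

import Mathlib

open MeasureTheory Filter Topology
open scoped NNReal ENNReal

noncomputable section

namespace Kinetic

/-- Momentum space `ℝ³` with its Euclidean norm. -/
abbrev Momentum : Type := EuclideanSpace ℝ (Fin 3)

/-- The unit sphere of `ℝ³`, the set of scattering directions. -/
abbrev Direction : Type := Metric.sphere (0 : Momentum) 1

/-! ### Relativistic kinematics (signature `(-,+,+,+)`, units `c = ħ = k_B = 1`) -/

/-- The Minkowski product `a_μ b^μ`. -/
def minkowski (a b : Fin 4 → ℝ) : ℝ :=
  -(a 0 * b 0) + ∑ j : Fin 3, a j.succ * b j.succ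

/-- The on-shell energy `p⁰ = √(m² + |p|²)`. -/
def energy (m : ℝ) (p : Momentum) : ℝ := Real.sqrt (m ^ 2 + ‖p‖ ^ 2)

/-- The on-shell four-momentum `p^μ = (p⁰, p)`. -/
def fourMomentum (m : ℝ) (p : Momentum) : Fin 4 → ℝ := Fin.cons (energy m p) fun j => p j

/-- The Lorentz factor `γ = 1 / √(1 - v²)` of a speed `v < 1`. -/
def lorentzFactor (v : ℝ) : ℝ := 1 / Real.sqrt (1 - v ^ 2)

/-- The four-velocity `u^μ = γ (1, V)` of an observer moving with velocity `V`. -/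
def fourVelocity (V : Momentum) : Fin 4 → ℝ :=
  fun μ => lorentzFactor ‖V‖ * (Fin.cons 1 (fun j => V j) : Fin 4 → ℝ) μ

/-- The Mandelstam invariant `s = -(p + q)_μ (p + q)^μ`, the squared center-of-mass energy. -/
def mandelstamS (m : ℝ) (p q : Momentum) : ℝ :=
  -minkowski (fourMomentum m p + fourMomentum m q) (fourMomentum m p + fourMomentum m q)

/-- The Møller velocity `√((p_μ q^μ)² - m⁴) / (p⁰ q⁰)`. -/
def mollerVelocity (m : ℝ) (p q : Momentum) : ℝ :=
  Real.sqrt ((minkowski (fourMomentum m p) (fourMomentum m q)) ^ 2 - m ^ 4)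
    / (energy m p * energy m q)

/-- The momentum `p'` of the first outgoing particle in an elastic collision of `p` with `q`.
In the center-of-mass frame it has direction `ω` and length `κ = √(s - 4 m²) / 2`; the formula
is its image under the pure boost from the center-of-mass frame. -/
def outgoing (m : ℝ) (p q ω : Momentum) : Momentum :=
  (1 / 2 : ℝ) • (p + q) +
    (Real.sqrt (mandelstamS m p q - 4 * m ^ 2) / 2) •
      (ω + (inner ℝ (p + q) ω / (Real.sqrt (mandelstamS m p q) *
        (energy m p + energy m q + Real.sqrt (mandelstamS m p q)))) • (p + q))

/-- The momentum `q' = p + q - p'` of the second outgoing particle. -/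
def outgoingPartner (m : ℝ) (p q ω : Momentum) : Momentum := p + q - outgoing m p q ω

/-- The cosine of the center-of-mass scattering angle, as the invariant
`(p - q)_μ (p' - q')^μ / (s - 4 m²)`. -/
def cosScattering (m : ℝ) (p q ω : Momentum) : ℝ :=
  minkowski (fourMomentum m p - fourMomentum m q)
      (fourMomentum m (outgoing m p q ω) - fourMomentum m (outgoingPartner m p q ω))
    / (mandelstamS m p q - 4 * m ^ 2)

/-! ### Gases and their Hilbert space -/

/-- A non-degenerate gas of identical spinless particles together with a uniform equilibrium
state of it, described in the rest frame of a fixed observer (who need not comove with the gas). -/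
structure Gas where
  /-- The mass of the particles; massless particles are allowed. -/
  mass : ℝ
  mass_nonneg : 0 ≤ mass
  /-- The fugacity exponent of the equilibrium state. -/
  α : ℝ
  /-- Time component of the inverse-temperature four-vector `β^μ = u_gas^μ / T`. -/
  β₀ : ℝ
  /-- Space components of the inverse-temperature four-vector. -/
  β : Momentum
  /-- `β^μ` is timelike and future-directed. -/
  β_timelike : ‖β‖ < β₀
  /-- The differential cross section, a function of `s` and of the cosine of the
  center-of-mass scattering angle. -/
  crossSection : ℝ → ℝ → ℝ≥0
  measurable_crossSection : Measurable (Function.uncurry crossSection)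

namespace Gas

variable (G : Gas)

/-- The equilibrium (Maxwell–Jüttner) distribution `f_eq = exp(α + β_μ p^μ)`. -/
def feq (p : Momentum) : ℝ :=
  Real.exp (G.α + minkowski (Fin.cons G.β₀ fun j => G.β j) (fourMomentum G.mass p))

/-- The measure `f_eq d³p / (2π)³`. -/
def measure : Measure Momentum :=
  volume.withDensity fun p => ENNReal.ofReal (G.feq p / (2 * Real.pi) ^ 3)

/-- The Hilbert space `L²(ℝ³, f_eq d³p / (2π)³)` of complex perturbations `ψ`. -/
abbrev State : Type := Lp ℂ 2 G.measure

/-! ### The linearized collision operator -/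

/-- The measure `(f_eq(q) d³q / (2π)³) dΩ` over collision partners and scattering directions. -/
def partnerMeasure : Measure (Momentum × Direction) :=
  G.measure.prod (volume : Measure Momentum).toSphere

/-- The collision rate `v_Møl σ(s, θ) / 2`, with the factor `1 / 2` of identical particles. -/
def rate (p : Momentum) (z : Momentum × Direction) : ℝ :=
  mollerVelocity G.mass p z.1 *
    G.crossSection (mandelstamS G.mass p z.1) (cosScattering G.mass p z.1 z.2) / 2

/-- The collisional balance `ψ(p) + ψ(q) - ψ(p') - ψ(q')`. -/
def balance (ψ : Momentum → ℂ) (p : Momentum) (z : Momentum × Direction) : ℂ :=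
  ψ p + ψ z.1 - ψ (outgoing G.mass p z.1 z.2) - ψ (outgoingPartner G.mass p z.1 z.2)

/-- The linearized collision integral
`(Iψ)(p) = ∫ (d³q/(2π)³) f_eq(q) ∫ dΩ (v_Møl σ / 2) (ψ(p) + ψ(q) - ψ(p') - ψ(q'))`. -/
def collisionIntegral (ψ : Momentum → ℂ) (p : Momentum) : ℂ :=
  ∫ z, (G.rate p z : ℂ) * G.balance ψ p z ∂G.partnerMeasure

/-- The collision integral of `ψ` with absolute values inside. -/
def absCollisionIntegral (ψ : Momentum → ℂ) (p : Momentum) : ℝ≥0∞ :=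
  ∫⁻ z, ‖(G.rate p z : ℂ) * G.balance ψ p z‖ₑ ∂G.partnerMeasure

/-- The natural domain of the linearized collision operator: the states whose collision integral
converges absolutely, to a square-integrable function. -/
def collisionDomain : Set G.State :=
  {ψ | ∫⁻ p, G.absCollisionIntegral ψ p ^ 2 ∂G.measure < ∞}

/-- The graph of the linearized collision operator on its natural domain. -/
def collisionGraph : Set (G.State × G.State) :=
  {x | x.1 ∈ G.collisionDomain ∧ x.2 =ᵐ[G.measure] G.collisionIntegral x.1}

end Gas

/-- The graph of the Friedrichs extension of a densely defined, symmetric, nonnegative operator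
`T` that is given by its graph: the restriction of the adjoint `T*` to the form domain, i.e. to
the limits of those sequences in the domain of `T` that are Cauchy for the form `(ψ, T ψ)`. -/
def friedrichsGraph {H : Type*} [NormedAddCommGroup H] [InnerProductSpace ℂ H]
    (T : Set (H × H)) : Set (H × H) :=
  {x | (∀ y ∈ T, inner ℂ y.2 x.1 = inner ℂ y.1 x.2) ∧
    ∃ z : ℕ → H × H, (∀ n, z n ∈ T) ∧ Tendsto (fun n => (z n).1) atTop (𝓝 x.1) ∧
      Tendsto (fun mn : ℕ × ℕ =>
        (inner ℂ ((z mn.1).1 - (z mn.2).1) ((z mn.1).2 - (z mn.2).2) : ℂ)) atTop (𝓝 0)}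

namespace Gas

variable (G : Gas)

/-- The graph of the collision operator `I`: the Friedrichs extension of the linearized collision
operator on its natural domain. -/
def collisionOperator : Set (G.State × G.State) := friedrichsGraph G.collisionGraph

/-! ### Eigenmodes, conserved currents and the non-hydrodynamic spectrum -/

/-- The velocity components `w^j = p^j / p⁰`. -/
def velocity (j : Fin 3) (p : Momentum) : ℝ := p j / energy G.mass p

/-- `x n = (ψ_n, I ψ_n)` is a sequence of normalized states in the domain of `I` with
`‖(I - iω + i k_j w^j) ψ_n‖ → 0`, where `k^μ = (ω, k^j)`: it exhibits `k^μ` as an eigenmode,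
belonging to the point or to the continuous spectrum. -/
def IsEigenSequence (k : Fin 4 → ℂ) (x : ℕ → G.State × G.State) : Prop :=
  (∀ n, x n ∈ G.collisionOperator) ∧ (∀ n, ‖(x n).1‖ = 1) ∧
    Tendsto (fun n => eLpNorm (fun p => (x n).2 p - Complex.I * k 0 * (x n).1 p +
      (∑ j : Fin 3, (G.velocity j p : ℂ) * (Complex.I * k j.succ)) * (x n).1 p) 2 G.measure)
      atTop (𝓝 0)

/-- The perturbation `δJ^μ = ∫ (d³p/(2π)³) f_eq (p^μ/p⁰) ψ` of the particle current. -/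
def currentJ (ψ : G.State) (μ : Fin 4) : ℂ :=
  ∫ p, ((fourMomentum G.mass p μ / energy G.mass p : ℝ) : ℂ) * ψ p ∂G.measure

/-- The perturbation `δT^{μν} = ∫ (d³p/(2π)³) f_eq (p^μ/p⁰) p^ν ψ` of the stress-energy tensor. -/
def currentT (ψ : G.State) (μ ν : Fin 4) : ℂ :=
  ∫ p, ((fourMomentum G.mass p μ / energy G.mass p * fourMomentum G.mass p ν : ℝ) : ℂ) * ψ p
    ∂G.measure

/-- The contraction `u_μ A^μ` of a real four-vector with a complex one. -/
def contract (u : Fin 4 → ℝ) (A : Fin 4 → ℂ) : ℂ :=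
  -((u 0 : ℂ) * A 0) + ∑ j : Fin 3, (u j.succ : ℂ) * A j.succ

/-- The state carries no conserved density relative to the observer with four-velocity `u`:
`u_μ δJ^μ = 0` and `u_μ δT^{μν} = 0`. -/
def NoConservedDensity (u : Fin 4 → ℝ) (ψ : G.State) : Prop :=
  contract u (G.currentJ ψ) = 0 ∧ ∀ ν, contract u (fun μ => G.currentT ψ μ ν) = 0

/-- The non-hydrodynamic spectrum at zero wavenumber relative to the observer with velocity `V`:
the frequencies `ω` for which `k^μ = ω u^μ` is an eigenmode, exhibited by a sequence of states
that carry no conserved density relative to that observer. -/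
def nonhydroSpectrum (V : Momentum) : Set ℂ :=
  {ω | ∃ x : ℕ → G.State × G.State,
    G.IsEigenSequence (fun μ => ω * (fourVelocity V μ : ℂ)) x ∧
      ∀ n, G.NoConservedDensity (fourVelocity V) (x n).1}

end Gas

/-- For every frequency `ω` in the set, `iω` is a real number with `a ≤ iω ≤ b`. -/
def Confined (S : Set ℂ) (a : ℝ) (b : EReal) : Prop :=
  ∀ ω ∈ S, ∃ r : ℝ, Complex.I * ω = (r : ℂ) ∧ a ≤ r ∧ (r : EReal) ≤ b

end Kinetic

end

/-!
Since `k_j w^j - ω` equals `-ω M` for `k^μ = ω u^μ`, where `M = -u_μ p^μ / p⁰ = γ (1 - V · w)`, the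
eigenmode equation reads `I ψ = iω M ψ`, and the states without conserved densities are those with
`M ψ` orthogonal to the collision invariants `N = span {1, p^ν}`, which lie in the kernel of `I`.
As `I` is self-adjoint, its spectrum at rest bounds its form: `a ‖P ψ‖² ≤ (ψ, I ψ) ≤ b ‖P ψ‖²`,
where `P` projects onto `Nᗮ`. Because `|w| ≤ 1`, the form of `M` lies between `γ (1 - v) ‖ψ‖²` and,
when `M ψ ⊥ N`, `γ (1 + v) ‖P ψ‖²`. Hence `iω = lim (ψₙ, I ψₙ) / (ψₙ, M ψₙ)` is real and lies
between `a / (γ (1 + v)) = γ (1 - v) a` and `b / (γ (1 - v))`.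

The collision operator on its natural domain is symmetric and nonnegative because, by conservation
of four-momentum, the distribution of collisions in equilibrium is invariant under exchange of the
incoming and the outgoing momenta. This is seen in the variables `(P, k)`, the total momentum and
the center-of-mass momentum of the pair: scattering only rotates `k`, and `v_Møl dp dq` has a
density with respect to `dP dk` that depends on `P` and `|k|` only.
-/

namespace Kinetic

section SelfAdjointOperator

variable {𝕜 E : Type*} [RCLike 𝕜] [NormedAddCommGroup E] [InnerProductSpace 𝕜 E]
  [CompleteSpace E]

theorem isUnit_of_isSelfAdjoint_of_mul_norm_le {B : E →L[𝕜] E} (hB : IsSelfAdjoint B) {ε : ℝ}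
    (hε : 0 < ε) (hbound : ∀ x, ε * ‖x‖ ≤ ‖B x‖) : IsUnit B := by
  have hanti : AntilipschitzWith ⟨ε⁻¹, by positivity⟩ B :=
    B.antilipschitz_of_bound fun x => (le_inv_mul_iff₀ hε).2 (hbound x)
  rw [ContinuousLinearMap.isUnit_iff_bijective,
    ContinuousLinearMap.bijective_iff_dense_range_and_antilipschitz]
  refine ⟨?_, _, hanti⟩
  rw [Submodule.topologicalClosure_eq_top_iff, ContinuousLinearMap.orthogonal_range,
    hB.adjoint_eq]
  exact LinearMap.ker_eq_bot.2 hanti.injective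

variable {H : Type*} [NormedAddCommGroup H] [InnerProductSpace ℂ H]

theorem exists_norm_eq_one_norm_sub_smul_lt [CompleteSpace H] {B : H →L[ℂ] H}
    (hB : IsSelfAdjoint B) {μ : ℝ} (hμ : μ ∈ spectrum ℝ B) {ε : ℝ} (hε : 0 < ε) :
    ∃ h : H, ‖h‖ = 1 ∧ ‖B h - (μ : ℂ) • h‖ < ε := by
  by_contra! hne
  refine hμ (isUnit_of_isSelfAdjoint_of_mul_norm_le
    ((IsSelfAdjoint.algebraMap _ (.all μ)).sub hB) hε fun x => ?_)
  have hval : ‖(algebraMap ℝ (H →L[ℂ] H) μ - B) x‖ = ‖B x - (μ : ℂ) • x‖ := by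
    rw [norm_sub_rev]
    simp [Algebra.algebraMap_eq_smul_one]
  rw [hval]
  rcases eq_or_ne x 0 with rfl | hx
  · simp
  · have hx' : ‖x‖ ≠ 0 := norm_ne_zero_iff.2 hx
    have hunit := hne (((‖x‖⁻¹ : ℝ) : ℂ) • x) (by simp [norm_smul, hx'])
    rwa [map_smul, smul_comm, ← smul_sub, norm_smul, Complex.norm_real, norm_inv, norm_norm,
      le_inv_mul_iff₀ (norm_pos_iff.2 hx), mul_comm] at hunit

theorem mul_norm_sq_le_re_inner_of_spectrum [CompleteSpace H] {B : H →L[ℂ] H}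
    (hB : IsSelfAdjoint B) {c : ℝ} (hc : ∀ μ ∈ spectrum ℝ B, c * μ ^ 2 ≤ μ) (h : H) :
    c * ‖B h‖ ^ 2 ≤ (inner ℂ (B h) h).re := by
  have hpos : (0 : H →L[ℂ] H) ≤ cfc (fun μ : ℝ => μ - c * μ ^ 2) B :=
    cfc_nonneg fun μ hμ => sub_nonneg.2 (hc μ hμ)
  rw [cfc_sub _ _ B, cfc_const_mul _ _ B, cfc_pow _ _ B, cfc_id' ℝ B,
    ContinuousLinearMap.nonneg_iff_isPositive] at hpos
  have hre := hpos.re_inner_nonneg_left h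
  have hsq : inner ℂ (B (B h)) h = ((‖B h‖ ^ 2 : ℝ) : ℂ) := by
    rw [hB.isSymmetric.apply_clm, inner_self_eq_norm_sq_to_K]
    simp
  simp only [sub_apply, smul_apply, pow_two B, mul_apply_eq_comp, inner_sub_left] at hre
  rw [← Complex.coe_smul, inner_smul_left, hsq] at hre
  simpa [← Complex.ofReal_pow] using hre

theorem re_inner_le_mul_norm_sq_of_spectrum [CompleteSpace H] {B : H →L[ℂ] H}
    (hB : IsSelfAdjoint B) {c : ℝ} (hc : ∀ μ ∈ spectrum ℝ B, μ ≤ c * μ ^ 2) (h : H) :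
    (inner ℂ (B h) h).re ≤ c * ‖B h‖ ^ 2 := by
  have hneg := mul_norm_sq_le_re_inner_of_spectrum hB.neg (c := -c) (fun μ hμ => ?_) h
  · simpa using hneg
  · rw [← spectrum.neg_eq, Set.mem_neg] at hμ
    have := hc _ hμ
    nlinarith

theorem mul_norm_sq_le_re_inner_of_smul_one_le {M : H →L[ℂ] H} {c : ℝ} (hM : c • 1 ≤ M)
    (ψ : H) : c * ‖ψ‖ ^ 2 ≤ (inner ℂ ψ (M ψ)).re := by
  have := (ContinuousLinearMap.le_def _ _).1 hM |>.re_inner_nonneg_right ψ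
  simpa [inner_sub_right, inner_smul_right_eq_smul, ← Complex.ofReal_pow] using this

theorem re_inner_le_mul_norm_sq_of_le_smul_one {M : H →L[ℂ] H} {C : ℝ} (hM : M ≤ C • 1)
    (ψ : H) : (inner ℂ ψ (M ψ)).re ≤ C * ‖ψ‖ ^ 2 := by
  have := (ContinuousLinearMap.le_def _ _).1 hM |>.re_inner_nonneg_right ψ
  simpa [inner_sub_right, inner_smul_right_eq_smul, ← Complex.ofReal_pow] using this

end SelfAdjointOperator

section Pencil

variable {H : Type*} [NormedAddCommGroup H] [InnerProductSpace ℂ H]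

/-- The approximate eigenvalues of the pencil `A - z M`, where `A` is an operator given by its
graph: normalized approximate eigenvectors `ψ` are required to satisfy `M ψ ⊥ N`. For `M = 1` this
is the approximate point spectrum of `A` on `Nᗮ`. -/
def pencilSpectrum (A : Set (H × H)) (M : H →L[ℂ] H) (N : Submodule ℂ H) : Set ℂ :=
  {z | ∃ x : ℕ → H × H, (∀ n, x n ∈ A) ∧ (∀ n, ‖(x n).1‖ = 1) ∧ (∀ n, M (x n).1 ∈ Nᗮ) ∧
    Tendsto (fun n => (x n).2 - z • M (x n).1) atTop (𝓝 0)}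

/-- `R` is the resolvent `(A + 1)⁻¹` of the self-adjoint operator (or, more generally, linear
relation) with graph `A`. -/
structure IsSelfAdjointResolvent [CompleteSpace H] (R : H →L[ℂ] H) (A : Set (H × H)) : Prop where
  isSelfAdjoint : IsSelfAdjoint R
  mem_iff : ∀ x, x ∈ A ↔ x.1 = R (x.1 + x.2)

theorem le_of_tendsto_sub_mul {m q : ℕ → ℝ} {c r s : ℝ} (hc : 0 < c) (hm : ∀ n, c ≤ m n)
    (hlim : Tendsto (fun n => q n - r * m n) atTop (𝓝 0)) (hs : ∀ n, s * m n ≤ q n) : s ≤ r := by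
  by_contra! hlt
  have hpos : 0 < (s - r) * c := mul_pos (sub_pos.2 hlt) hc
  refine hpos.not_ge (ge_of_tendsto hlim (.of_forall fun n => ?_))
  have := mul_le_mul_of_nonneg_left (hm n) (sub_pos.2 hlt).le
  linarith [hs n]

section RealSequences

variable {q m d : ℕ → ℝ} {a c C r : ℝ} (hc : 0 < c) (hcm : ∀ n, c ≤ m n)
  (hlim : Tendsto (fun n => q n - r * m n) atTop (𝓝 0))

include hc hcm hlim

theorem div_le_of_tendsto_sub_mul (hC : 0 < C) (hmd : ∀ n, m n ≤ C * d n) (ha : 0 ≤ a)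
    (haq : ∀ n, a * d n ≤ q n) : a / C ≤ r :=
  le_of_tendsto_sub_mul hc hcm hlim fun n =>
    calc a / C * m n ≤ a / C * (C * d n) := by gcongr; exact hmd n
      _ = a * d n := by field_simp
      _ ≤ q n := haq n

theorem le_div_of_tendsto_sub_mul {b : ℝ} (hd : ∀ n, d n ≤ 1) (hb : 0 ≤ b)
    (hqb : ∀ n, q n ≤ b * d n) : r ≤ b / c := by
  refine neg_le_neg_iff.1 (le_of_tendsto_sub_mul (q := -q) hc hcm
    (by simpa [sub_eq_add_neg, add_comm] using hlim.neg) fun n => ?_)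
  have hdm : c * d n ≤ m n := (mul_le_of_le_one_right hc.le (hd n)).trans (hcm n)
  have hqm : q n ≤ b / c * m n :=
    calc q n ≤ b * d n := hqb n
      _ = b / c * (c * d n) := by field_simp
      _ ≤ b / c * m n := by gcongr
  simpa using hqm

theorem le_ereal_div_of_tendsto_sub_mul {b : EReal} (hd0 : 0 < d 0) (hd : ∀ n, d n ≤ 1)
    (ha : 0 ≤ a) (haq : ∀ n, a * d n ≤ q n)
    (hqb : ∀ b' : ℝ, b ≤ b' → ∀ n, q n ≤ b' * d n) : (r : EReal) ≤ b / (c : EReal) := by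
  have hnonneg (b' : ℝ) (hb : b ≤ b') : 0 ≤ b' :=
    ha.trans (le_of_mul_le_mul_right ((haq 0).trans (hqb b' hb 0)) hd0)
  induction b with
  | bot => linarith [hnonneg (-1) bot_le]
  | top => simp [EReal.top_div_of_pos_ne_top (EReal.coe_pos.2 hc) (EReal.coe_ne_top _)]
  | coe b =>
    rw [← EReal.coe_div, EReal.coe_le_coe_iff]
    exact le_div_of_tendsto_sub_mul hc hcm hlim hd (hnonneg b le_rfl) (hqb b le_rfl)

end RealSequences

theorem exists_real_of_tendsto_sub_mul {m q : ℕ → ℝ} {c : ℝ} {z : ℂ} (hc : 0 < c)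
    (hm : ∀ n, c ≤ m n) (hlim : Tendsto (fun n => (q n : ℂ) - z * m n) atTop (𝓝 0)) :
    ∃ r : ℝ, z = r ∧ Tendsto (fun n => q n - r * m n) atTop (𝓝 0) := by
  have him : Tendsto (fun n => z.im * m n) atTop (𝓝 0) := by
    simpa using ((Complex.continuous_im.tendsto _).comp hlim).neg
  have hnonneg : 0 ≤ z.im := le_of_tendsto_sub_mul (q := 0) hc hm (by simpa using him.neg) (by simp)
  have hnonpos : 0 ≤ -z.im := le_of_tendsto_sub_mul (q := 0) hc hm (by simpa using him) (by simp)
  have hz : z = z.re := Complex.ext rfl (by simpa using le_antisymm (neg_nonneg.1 hnonpos) hnonneg)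
  rw [hz] at hlim
  exact ⟨z.re, hz, by simpa [Function.comp_def] using (Complex.continuous_re.tendsto _).comp hlim⟩

namespace IsSelfAdjointResolvent

variable [CompleteSpace H] {R : H →L[ℂ] H} {A : Set (H × H)} (hR : IsSelfAdjointResolvent R A)
  {M : H →L[ℂ] H} {N : Submodule ℂ H} {x : H × H} {z : ℂ}

include hR

theorem smul_mem (hx : x ∈ A) (t : ℂ) : t • x ∈ A := by
  rw [hR.mem_iff] at hx ⊢
  rw [Prod.smul_fst, Prod.smul_snd, ← smul_add, map_smul, ← hx]

theorem mem_pencilSpectrum_of_le_norm {δ : ℝ} (hδ : 0 < δ) {x : ℕ → H × H} (hx : ∀ n, x n ∈ A)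
    (hx1 : ∀ n, δ ≤ ‖(x n).1‖) (hM : ∀ n, M (x n).1 ∈ Nᗮ)
    (hlim : Tendsto (fun n => (x n).2 - z • M (x n).1) atTop (𝓝 0)) :
    z ∈ pencilSpectrum A M N := by
  have hnorm (n : ℕ) : ‖((‖(x n).1‖⁻¹ : ℝ) : ℂ)‖ = ‖(x n).1‖⁻¹ := by simp
  refine ⟨fun n => ((‖(x n).1‖⁻¹ : ℝ) : ℂ) • x n, fun n => hR.smul_mem (hx n) _, fun n => ?_,
    fun n => ?_, ?_⟩
  · rw [Prod.smul_fst, norm_smul, hnorm, inv_mul_cancel₀ (hδ.trans_le (hx1 n)).ne']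
  · rw [Prod.smul_fst, map_smul]
    exact Nᗮ.smul_mem _ (hM n)
  · refine squeeze_zero_norm (fun n => ?_) (by simpa using hlim.norm.const_mul δ⁻¹)
    rw [Prod.smul_fst, Prod.smul_snd, map_smul, smul_comm, ← smul_sub, norm_smul, hnorm]
    gcongr
    exact hx1 n

theorem im_inner_eq_zero (hx : x ∈ A) : (inner ℂ x.1 x.2).im = 0 := by
  have hre : (inner ℂ (R (x.1 + x.2)) (x.1 + x.2)).im = 0 :=
    hR.isSelfAdjoint.isSymmetric.im_inner_apply_self _
  rw [← (hR.mem_iff x).1 hx, inner_add_right, Complex.add_im] at hre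
  rwa [show (inner ℂ x.1 x.1).im = 0 from inner_self_im (𝕜 := ℂ) x.1, zero_add] at hre

theorem inner_snd_eq_zero {ν : H} (hν : (ν, 0) ∈ A) (hx : x ∈ A) : inner ℂ ν x.2 = 0 := by
  have hRν : R ν = ν := by simpa using ((hR.mem_iff _).1 hν).symm
  have hsnd : x.2 = (x.1 + x.2) - R (x.1 + x.2) := by
    rw [← (hR.mem_iff x).1 hx, add_sub_cancel_left]
  rw [hsnd, inner_sub_right, ← hR.isSelfAdjoint.isSymmetric.apply_clm, hRν, sub_self]

variable (hN : ∀ ν ∈ N, (ν, 0) ∈ A)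

include hN

theorem snd_mem_orthogonal (hx : x ∈ A) : x.2 ∈ Nᗮ :=
  (Submodule.mem_orthogonal _ _).2 fun ν hν => hR.inner_snd_eq_zero (hN ν hν) hx

variable [N.HasOrthogonalProjection]

theorem sub_starProjection_apply (h : H) :
    (R - N.starProjection) h = R (Nᗮ.starProjection h) := by
  have hfix : R (N.starProjection h) = N.starProjection h := by
    simpa using ((hR.mem_iff _).1 (hN _ (N.starProjection_apply_mem h))).symm
  conv_rhs => rw [N.starProjection_orthogonal']
  simp [hfix]

theorem sub_starProjection_mem (h : H) :
    ((R - N.starProjection) h, Nᗮ.starProjection h - (R - N.starProjection) h) ∈ A := by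
  rw [hR.mem_iff, add_sub_cancel, hR.sub_starProjection_apply hN]

theorem sub_starProjection_mem_orthogonal (h : H) : (R - N.starProjection) h ∈ Nᗮ := by
  have hsnd := hR.snd_mem_orthogonal hN (hR.sub_starProjection_mem hN h)
  simpa using Nᗮ.sub_mem (Nᗮ.starProjection_apply_mem h) hsnd

theorem sub_starProjection_add_of_mem (hx : x ∈ A) :
    (R - N.starProjection) (x.1 + x.2) = Nᗮ.starProjection x.1 := by
  have hproj : N.starProjection x.2 = 0 :=
    N.starProjection_apply_eq_zero_iff.2 (hR.snd_mem_orthogonal hN hx)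
  rw [sub_apply, ← (hR.mem_iff x).1 hx, map_add, hproj, add_zero, N.starProjection_orthogonal']
  rfl

theorem re_inner_starProjection_add_of_mem (hx : x ∈ A) :
    (inner ℂ (Nᗮ.starProjection x.1) (x.1 + x.2)).re =
      ‖Nᗮ.starProjection x.1‖ ^ 2 + (inner ℂ x.1 x.2).re := by
  have hfix : Nᗮ.starProjection x.2 = x.2 :=
    Nᗮ.starProjection_eq_self_iff.2 (hR.snd_mem_orthogonal hN hx)
  have hself : (inner ℂ (Nᗮ.starProjection x.1) x.1).re = ‖Nᗮ.starProjection x.1‖ ^ 2 :=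
    Nᗮ.re_inner_starProjection_eq_normSq x.1
  rw [inner_add_right, Submodule.inner_starProjection_left_eq_right _ x.1 x.2, hfix,
    Complex.add_re, hself]

theorem inv_sub_one_mem_pencilSpectrum {μ : ℝ} (hμ : μ ∈ spectrum ℝ (R - N.starProjection))
    (hμ0 : μ ≠ 0) : ((μ⁻¹ - 1 : ℝ) : ℂ) ∈ pencilSpectrum A 1 N := by
  set B := R - N.starProjection with hB
  have hμpos : 0 < |μ| := abs_pos.2 hμ0
  choose h hnorm hlt using fun n : ℕ => exists_norm_eq_one_norm_sub_smul_lt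
    (hR.isSelfAdjoint.sub (isSelfAdjoint_starProjection N)) hμ
    (ε := |μ| / 2 * (1 / ((n : ℝ) + 1))) (by positivity)
  have hlim : Tendsto (fun n => B (h n) - (μ : ℂ) • h n) atTop (𝓝 0) :=
    squeeze_zero_norm (fun n => (hlt n).le)
      (by simpa using (tendsto_one_div_add_atTop_nhds_zero_nat (𝕜 := ℝ)).const_mul (|μ| / 2))
  have hlow (n : ℕ) : |μ| / 2 ≤ ‖B (h n)‖ := by
    have hsmul : ‖(μ : ℂ) • h n‖ = |μ| := by simp [norm_smul, hnorm]
    have htri := norm_sub_norm_le ((μ : ℂ) • h n) (B (h n))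
    have hone : |μ| / 2 * (1 / ((n : ℝ) + 1)) ≤ |μ| / 2 :=
      mul_le_of_le_one_right (by positivity) (div_le_one_of_le₀ (by simp) (by positivity))
    rw [norm_sub_rev, hsmul] at htri
    linarith [hlt n]
  refine hR.mem_pencilSpectrum_of_le_norm (half_pos hμpos)
    (fun n => hR.sub_starProjection_mem hN (h n)) hlow
    (fun n => hR.sub_starProjection_mem_orthogonal hN (h n)) ?_
  have hres (n : ℕ) : Nᗮ.starProjection (h n) - B (h n) -
      ((μ⁻¹ - 1 : ℝ) : ℂ) • B (h n) =
      -(μ : ℂ)⁻¹ • Nᗮ.starProjection (B (h n) - (μ : ℂ) • h n) := by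
    have hfix : Nᗮ.starProjection (B (h n)) = B (h n) :=
      Nᗮ.starProjection_eq_self_iff.2 (hR.sub_starProjection_mem_orthogonal hN (h n))
    have hμ1 : (μ : ℂ)⁻¹ * (μ : ℂ) = 1 := inv_mul_cancel₀ (Complex.ofReal_ne_zero.2 hμ0)
    rw [map_sub, map_smul, hfix, smul_sub, smul_smul, neg_mul, hμ1]
    push_cast
    module
  simp only [← hB, one_apply_eq_self, hres]
  simpa using ((Nᗮ.starProjection.continuous.tendsto _).comp hlim).const_smul (-(μ : ℂ)⁻¹)

theorem mul_norm_sq_le_re_inner_of_mem {a : ℝ}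
    (ha : ∀ r : ℝ, (r : ℂ) ∈ pencilSpectrum A 1 N → a ≤ r) (hx : x ∈ A) :
    a * ‖Nᗮ.starProjection x.1‖ ^ 2 ≤ (inner ℂ x.1 x.2).re := by
  have hle := mul_norm_sq_le_re_inner_of_spectrum (c := 1 + a)
    (hR.isSelfAdjoint.sub (isSelfAdjoint_starProjection N)) (fun μ hμ => ?_) (x.1 + x.2)
  · rw [hR.sub_starProjection_add_of_mem hN hx, hR.re_inner_starProjection_add_of_mem hN hx] at hle
    linarith
  · rcases eq_or_ne μ 0 with rfl | hμ0
    · simp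
    · have hsplit : μ = (1 + (μ⁻¹ - 1)) * μ ^ 2 := by field_simp; ring
      have := ha _ (hR.inv_sub_one_mem_pencilSpectrum hN hμ hμ0)
      conv_rhs => rw [hsplit]
      gcongr

theorem re_inner_le_mul_norm_sq_of_mem {b : ℝ}
    (hb : ∀ r : ℝ, (r : ℂ) ∈ pencilSpectrum A 1 N → r ≤ b) (hx : x ∈ A) :
    (inner ℂ x.1 x.2).re ≤ b * ‖Nᗮ.starProjection x.1‖ ^ 2 := by
  have hle := re_inner_le_mul_norm_sq_of_spectrum (c := 1 + b)
    (hR.isSelfAdjoint.sub (isSelfAdjoint_starProjection N)) (fun μ hμ => ?_) (x.1 + x.2)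
  · rw [hR.sub_starProjection_add_of_mem hN hx, hR.re_inner_starProjection_add_of_mem hN hx] at hle
    linarith
  · rcases eq_or_ne μ 0 with rfl | hμ0
    · simp
    · have hsplit : μ = (1 + (μ⁻¹ - 1)) * μ ^ 2 := by field_simp; ring
      have := hb _ (hR.inv_sub_one_mem_pencilSpectrum hN hμ hμ0)
      conv_lhs => rw [hsplit]
      gcongr

end IsSelfAdjointResolvent

section Comparison

variable {M : H →L[ℂ] H} {N : Submodule ℂ H}

theorem re_inner_le_mul_norm_starProjection_sq [CompleteSpace H] [N.HasOrthogonalProjection]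
    {C : ℝ} (hM0 : 0 ≤ M) (hM : M ≤ C • 1) {ψ : H} (hψ : M ψ ∈ Nᗮ) :
    (inner ℂ ψ (M ψ)).re ≤ C * ‖Nᗮ.starProjection ψ‖ ^ 2 := by
  have hpos := ContinuousLinearMap.nonneg_iff_isPositive M |>.1 hM0
  set ν := N.starProjection ψ with hν
  set φ := Nᗮ.starProjection ψ with hφ
  have hsum : φ = ψ - ν := by simp [hφ, hν, N.starProjection_orthogonal']
  have hνψ : inner ℂ ν (M ψ) = 0 :=
    (Submodule.mem_orthogonal _ _).1 hψ _ (N.starProjection_apply_mem ψ)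
  have hψν : inner ℂ ψ (M ν) = 0 := by
    rw [← hpos.isSelfAdjoint.isSymmetric.apply_clm, ← inner_conj_symm, hνψ, map_zero]
  calc (inner ℂ ψ (M ψ)).re ≤ (inner ℂ ψ (M ψ)).re + (inner ℂ ν (M ν)).re :=
        le_add_of_nonneg_right (hpos.re_inner_nonneg_right ν)
    _ = (inner ℂ φ (M φ)).re := by
        simp [hsum, hνψ, hψν]
    _ ≤ C * ‖φ‖ ^ 2 := re_inner_le_mul_norm_sq_of_le_smul_one hM φ

theorem tendsto_inner_sub_mul_inner {z : ℂ} {x : ℕ → H × H} (hnorm : ∀ n, ‖(x n).1‖ = 1)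
    (hlim : Tendsto (fun n => (x n).2 - z • M (x n).1) atTop (𝓝 0)) :
    Tendsto (fun n => inner ℂ (x n).1 (x n).2 - z * inner ℂ (x n).1 (M (x n).1)) atTop
      (𝓝 0) := by
  refine squeeze_zero_norm (fun n => ?_) (by simpa using hlim.norm)
  rw [← inner_smul_right, ← inner_sub_right]
  simpa [hnorm n] using norm_inner_le_norm (𝕜 := ℂ) (x n).1 ((x n).2 - z • M (x n).1)

variable [CompleteSpace H] [N.HasOrthogonalProjection] {R : H →L[ℂ] H} {A : Set (H × H)}

-- The form of `A` is compared with that of `M` by way of `‖P ψ‖²`, `P` the projection onto `Nᗮ`: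
-- `a ‖P ψ‖² ≤ (ψ, A ψ) ≤ b ‖P ψ‖²` and, if `M ψ ⊥ N`, `c ‖P ψ‖² ≤ c ‖ψ‖² ≤ (ψ, M ψ) ≤ C ‖P ψ‖²`.
theorem IsSelfAdjointResolvent.confined_pencilSpectrum (hR : IsSelfAdjointResolvent R A)
    (hN : ∀ ν ∈ N, (ν, 0) ∈ A) {c C : ℝ} (hc : 0 < c) (hMc : c • 1 ≤ M)
    (hMC : M ≤ C • 1) {a : ℝ} (ha : 0 ≤ a) {b : EReal}
    (hspec : ∀ r : ℝ, (r : ℂ) ∈ pencilSpectrum A 1 N → a ≤ r ∧ (r : EReal) ≤ b)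
    {z : ℂ} (hz : z ∈ pencilSpectrum A M N) :
    ∃ r : ℝ, z = r ∧ a / C ≤ r ∧ (r : EReal) ≤ b / (c : EReal) := by
  obtain ⟨x, hx, hnorm, hMN, hlim⟩ := hz
  set q : ℕ → ℝ := fun n => (inner ℂ (x n).1 (x n).2).re
  set m : ℕ → ℝ := fun n => (inner ℂ (x n).1 (M (x n).1)).re
  set d : ℕ → ℝ := fun n => ‖Nᗮ.starProjection (x n).1‖ ^ 2
  have hM0 : 0 ≤ M := (smul_nonneg hc.le zero_le_one).trans hMc
  have hMsymm := ((ContinuousLinearMap.nonneg_iff_isPositive M).1 hM0).isSelfAdjoint.isSymmetric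
  have hcm (n : ℕ) : c ≤ m n := by
    simpa [hnorm n] using mul_norm_sq_le_re_inner_of_smul_one_le hMc (x n).1
  have hmd (n : ℕ) : m n ≤ C * d n := re_inner_le_mul_norm_starProjection_sq hM0 hMC (hMN n)
  have hd (n : ℕ) : d n ≤ 1 :=
    pow_le_one₀ (norm_nonneg _) ((Nᗮ.norm_starProjection_apply_le _).trans (hnorm n).le)
  have haq (n : ℕ) : a * d n ≤ q n :=
    hR.mul_norm_sq_le_re_inner_of_mem hN (fun r hr => (hspec r hr).1) (hx n)
  have hqb (b' : ℝ) (hb : b ≤ b') (n : ℕ) : q n ≤ b' * d n :=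
    hR.re_inner_le_mul_norm_sq_of_mem hN
      (fun r hr => EReal.coe_le_coe_iff.1 ((hspec r hr).2.trans hb)) (hx n)
  obtain ⟨r, hzr, hr⟩ := exists_real_of_tendsto_sub_mul (q := q) hc hcm
    ((tendsto_inner_sub_mul_inner hnorm hlim).congr fun n => by
      congr 2
      · exact Complex.ext rfl (hR.im_inner_eq_zero (hx n))
      · exact Complex.ext rfl (hMsymm.im_inner_self_apply _))
  have hCd : 0 < C * d 0 := hc.trans_le ((hcm 0).trans (hmd 0))
  have hC : 0 < C := pos_of_mul_pos_left hCd (sq_nonneg _)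
  exact ⟨r, hzr, div_le_of_tendsto_sub_mul hc hcm hr hC hmd ha haq,
    le_ereal_div_of_tendsto_sub_mul hc hcm hr (pos_of_mul_pos_right hCd hC.le) hd ha haq hqb⟩

end Comparison

end Pencil

section Friedrichs

variable {H : Type*} [NormedAddCommGroup H] [InnerProductSpace ℂ H] {T : Submodule ℂ (H × H)}

/-- The operator with graph `T` is symmetric and nonnegative. -/
structure IsNonnegSymmetric (T : Submodule ℂ (H × H)) : Prop where
  symm : ∀ x ∈ T, ∀ y ∈ T, inner ℂ y.2 x.1 = inner ℂ y.1 x.2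
  nonneg : ∀ x ∈ T, 0 ≤ (inner ℂ x.1 x.2).re

/-- The form domain of a nonnegative symmetric operator before completion: its graph, with the
inner product `(ψ, φ) + (ψ, T φ)`. -/
def FormDomain (_hT : IsNonnegSymmetric T) : Type _ := T

namespace FormDomain

variable {hT : IsNonnegSymmetric T}

instance : AddCommGroup (FormDomain hT) := inferInstanceAs (AddCommGroup T)

instance : Module ℂ (FormDomain hT) := inferInstanceAs (Module ℂ T)

noncomputable instance : PreInnerProductSpace.Core ℂ (FormDomain hT) where
  inner x y := inner ℂ x.1.1 y.1.1 + inner ℂ x.1.1 y.1.2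
  conj_inner_symm x y := by
    rw [map_add, inner_conj_symm, inner_conj_symm, hT.symm _ y.2 _ x.2]
  re_inner_nonneg x := by
    rw [map_add]
    exact add_nonneg (inner_self_nonneg (𝕜 := ℂ) (x := x.1.1)) (hT.nonneg _ x.2)
  add_left x y z := by
    change inner ℂ (x.1.1 + y.1.1) z.1.1 + inner ℂ (x.1.1 + y.1.1) z.1.2 = _
    rw [inner_add_left, inner_add_left]
    ring
  smul_left x y r := by
    change inner ℂ (r • x.1.1) y.1.1 + inner ℂ (r • x.1.1) y.1.2 = _
    rw [inner_smul_left, inner_smul_left, mul_add]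

noncomputable instance : SeminormedAddCommGroup (FormDomain hT) :=
  InnerProductSpace.Core.toSeminormedAddCommGroup (𝕜 := ℂ)

noncomputable instance : InnerProductSpace ℂ (FormDomain hT) :=
  InnerProductSpace.ofCore inferInstance

theorem inner_def (x y : FormDomain hT) :
    inner ℂ x y = inner ℂ x.1.1 y.1.1 + inner ℂ x.1.1 y.1.2 := rfl

theorem inner_fst_snd (x : FormDomain hT) :
    inner ℂ x.1.1 x.1.2 = ((‖x‖ ^ 2 - ‖x.1.1‖ ^ 2 : ℝ) : ℂ) := by
  have hself := inner_self_eq_norm_sq_to_K (𝕜 := ℂ) x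
  rw [inner_def, inner_self_eq_norm_sq_to_K] at hself
  push_cast
  exact eq_sub_of_add_eq' hself

theorem norm_fst_le (x : FormDomain hT) : ‖x.1.1‖ ≤ ‖x‖ := by
  have hre := hT.nonneg _ x.2
  rw [inner_fst_snd, Complex.ofReal_re, sub_nonneg] at hre
  exact le_of_sq_le_sq hre (norm_nonneg _)

theorem cauchySeq_iff_tendsto_inner {z : ℕ → FormDomain hT}
    (hz : CauchySeq fun n => (z n).1.1) :
    CauchySeq z ↔ Tendsto (fun mn : ℕ × ℕ => (inner ℂ ((z mn.1).1.1 - (z mn.2).1.1)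
      ((z mn.1).1.2 - (z mn.2).1.2) : ℂ)) atTop (𝓝 0) := by
  have hfst := (cauchySeq_iff_tendsto_dist_atTop_0.1 hz).pow 2
  have hinner (mn : ℕ × ℕ) :
      (inner ℂ ((z mn.1).1.1 - (z mn.2).1.1) ((z mn.1).1.2 - (z mn.2).1.2) : ℂ) =
        ((dist (z mn.1) (z mn.2) ^ 2 - dist (z mn.1).1.1 (z mn.2).1.1 ^ 2 : ℝ) : ℂ) := by
    rw [dist_eq_norm, dist_eq_norm]
    exact inner_fst_snd (z mn.1 - z mn.2)
  simp only [hinner, cauchySeq_iff_tendsto_dist_atTop_0]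
  rw [← Complex.ofReal_zero, Filter.tendsto_ofReal_iff]
  refine ⟨fun h => by simpa using (h.pow 2).sub hfst, fun h => ?_⟩
  simpa [Real.sqrt_sq dist_nonneg] using (h.add hfst).sqrt

theorem exists_seq_tendsto (η : UniformSpace.Completion (FormDomain hT)) :
    ∃ z : ℕ → FormDomain hT,
      Tendsto (fun n => (z n : UniformSpace.Completion (FormDomain hT))) atTop (𝓝 η) := by
  obtain ⟨u, hu, hlim⟩ :=
    mem_closure_iff_seq_limit.1 (UniformSpace.Completion.denseRange_coe (α := FormDomain hT) η)
  choose z hz using hu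
  exact ⟨z, by simpa only [hz] using hlim⟩

variable (hT)

/-- The inclusion of the form domain into the Hilbert space. -/
noncomputable def inclusion : FormDomain hT →L[ℂ] H :=
  LinearMap.mkContinuous
    { toFun x := x.1.1
      map_add' _ _ := rfl
      map_smul' _ _ := rfl } 1 fun x => (norm_fst_le x).trans_eq (one_mul _).symm

/-- The inclusion of the completed form domain into the Hilbert space. -/
noncomputable def completionInclusion [CompleteSpace H] :
    UniformSpace.Completion (FormDomain hT) →L[ℂ] H :=
  (inclusion hT).extend (UniformSpace.Completion.toComplL (𝕜 := ℂ))

variable {hT} [CompleteSpace H]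

theorem completionInclusion_coe (x : FormDomain hT) : completionInclusion hT x = x.1.1 :=
  (inclusion hT).extend_eq (e := UniformSpace.Completion.toComplL (𝕜 := ℂ))
    UniformSpace.Completion.denseRange_coe (UniformSpace.Completion.isUniformInducing_coe _) x

theorem inner_coe_left (y : FormDomain hT) (η : UniformSpace.Completion (FormDomain hT)) :
    inner ℂ (y : UniformSpace.Completion (FormDomain hT)) η =
      inner ℂ y.1.1 (completionInclusion hT η) + inner ℂ y.1.2 (completionInclusion hT η) := by
  induction η using UniformSpace.Completion.induction_on with
  | hp => exact isClosed_eq (by fun_prop) (by fun_prop)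
  | ih x =>
    rw [UniformSpace.Completion.inner_coe, completionInclusion_coe, inner_def, hT.symm _ x.2 _ y.2]

end FormDomain

open ContinuousLinearMap FormDomain

namespace IsNonnegSymmetric

theorem subset_friedrichsGraph (hT : IsNonnegSymmetric T) :
    (T : Set (H × H)) ⊆ friedrichsGraph (T : Set (H × H)) := fun x hx =>
  ⟨fun y hy => hT.symm x hx y hy, fun _ => x, fun _ => hx, tendsto_const_nhds, by simp⟩

variable [CompleteSpace H] (hT : IsNonnegSymmetric T)

/-- The resolvent `(A + 1)⁻¹ = J J†` of the Friedrichs extension `A`, where `J` is the inclusion of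
the completed form domain. -/
noncomputable def friedrichsResolvent : H →L[ℂ] H :=
  completionInclusion hT ∘L adjoint (completionInclusion hT)

theorem mem_friedrichsGraph_of_eq {x : H × H} (hx : x.1 = hT.friedrichsResolvent (x.1 + x.2)) :
    x ∈ friedrichsGraph (T : Set (H × H)) := by
  set η := adjoint (completionInclusion hT) (x.1 + x.2) with hη
  have hJη : completionInclusion hT η = x.1 := hx.symm
  refine ⟨fun y hy => ?_, ?_⟩
  · let y' : FormDomain hT := ⟨y, hy⟩
    have hinner := inner_coe_left y' η
    rw [hJη, hη, adjoint_inner_right, completionInclusion_coe, inner_add_right] at hinner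
    exact (add_left_cancel hinner).symm
  · obtain ⟨z, hz⟩ := exists_seq_tendsto η
    have hfst : Tendsto (fun n => (z n).1.1) atTop (𝓝 x.1) := by
      rw [← hJη]
      exact (((completionInclusion hT).continuous.tendsto _).comp hz).congr fun n =>
        completionInclusion_coe (z n)
    have hcauchy : CauchySeq z :=
      (UniformSpace.Completion.isUniformInducing_coe _).cauchy_map_iff.1 hz.cauchySeq
    exact ⟨fun n => (z n).1, fun n => (z n).2, hfst,
      (cauchySeq_iff_tendsto_inner hfst.cauchySeq).1 hcauchy⟩

theorem eq_friedrichsResolvent_of_mem {x : H × H} (hx : x ∈ friedrichsGraph (T : Set (H × H))) :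
    x.1 = hT.friedrichsResolvent (x.1 + x.2) := by
  obtain ⟨hadj, z, hz, hlim, hform⟩ := hx
  let w : ℕ → FormDomain hT := fun n => ⟨z n, hz n⟩
  have hw : CauchySeq w := (cauchySeq_iff_tendsto_inner hlim.cauchySeq).2 hform
  obtain ⟨η, hη⟩ := cauchySeq_tendsto_of_complete
    ((UniformSpace.Completion.uniformContinuous_coe _).comp_cauchySeq hw)
  have hJη : completionInclusion hT η = x.1 :=
    tendsto_nhds_unique (((completionInclusion hT).continuous.tendsto _).comp hη)
      (hlim.congr fun n => (completionInclusion_coe (w n)).symm)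
  suffices hadjoint : η = adjoint (completionInclusion hT) (x.1 + x.2) by
    rw [friedrichsResolvent, ContinuousLinearMap.comp_apply, ← hadjoint, hJη]
  refine ext_inner_left ℂ fun v => ?_
  induction v using UniformSpace.Completion.induction_on with
  | hp => exact isClosed_eq (by fun_prop) (by fun_prop)
  | ih y =>
    rw [inner_coe_left, adjoint_inner_right, completionInclusion_coe, hJη, hadj _ y.2,
      inner_add_right]

theorem isSelfAdjointResolvent_friedrichsResolvent :
    IsSelfAdjointResolvent hT.friedrichsResolvent (friedrichsGraph (T : Set (H × H))) where
  isSelfAdjoint := (isPositive_self_comp_adjoint (completionInclusion hT)).isSelfAdjoint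
  mem_iff _ := ⟨hT.eq_friedrichsResolvent_of_mem, hT.mem_friedrichsGraph_of_eq⟩

end IsNonnegSymmetric

end Friedrichs

section Kinematics

variable (m : ℝ) (p q P : Momentum) {k ω : Momentum}

theorem minkowski_fourMomentum :
    minkowski (fourMomentum m p) (fourMomentum m q) =
      -(energy m p * energy m q) + inner ℝ p q := by
  simp [minkowski, fourMomentum, PiLp.inner_apply, mul_comm]

theorem energy_nonneg : 0 ≤ energy m p := Real.sqrt_nonneg _

theorem energy_sq : energy m p ^ 2 = m ^ 2 + ‖p‖ ^ 2 := Real.sq_sqrt (by positivity)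

theorem norm_le_energy : ‖p‖ ≤ energy m p := Real.le_sqrt_of_sq_le (by nlinarith [sq_nonneg m])

theorem energy_pos (hk : k ≠ 0) : 0 < energy m k :=
  (norm_pos_iff.2 hk).trans_le (norm_le_energy m k)

variable {p q} in
theorem energy_eq_of_norm_eq (h : ‖p‖ = ‖q‖) : energy m p = energy m q := by
  rw [energy, energy, h]

theorem mandelstamS_eq_two_mul :
    mandelstamS m p q = 2 * (m ^ 2 - minkowski (fourMomentum m p) (fourMomentum m q)) := by
  have hp : minkowski (fourMomentum m p) (fourMomentum m p) = -m ^ 2 := by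
    rw [minkowski_fourMomentum, ← pow_two, energy_sq, real_inner_self_eq_norm_sq]
    ring
  have hq : minkowski (fourMomentum m q) (fourMomentum m q) = -m ^ 2 := by
    rw [minkowski_fourMomentum, ← pow_two, energy_sq, real_inner_self_eq_norm_sq]
    ring
  have hexpand (a b : Fin 4 → ℝ) :
      minkowski (a + b) (a + b) = minkowski a a + 2 * minkowski a b + minkowski b b := by
    simp only [minkowski, Pi.add_apply, Fin.sum_univ_three]
    ring
  rw [mandelstamS, hexpand, hp, hq]
  ring

theorem mandelstamS_eq : mandelstamS m p q = (energy m p + energy m q) ^ 2 - ‖p + q‖ ^ 2 := by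
  rw [mandelstamS_eq_two_mul, minkowski_fourMomentum, norm_add_sq_real, add_sq, energy_sq,
    energy_sq]
  ring

theorem mandelstamS_nonneg : 0 ≤ mandelstamS m p q := by
  rw [mandelstamS_eq, sub_nonneg]
  have := (norm_add_le p q).trans (add_le_add (norm_le_energy m p) (norm_le_energy m q))
  gcongr

theorem mandelstamS_comm : mandelstamS m p q = mandelstamS m q p := by
  rw [mandelstamS_eq, mandelstamS_eq, add_comm p, add_comm (energy m p)]

theorem mollerVelocity_eq : mollerVelocity m p q =
    √(mandelstamS m p q * (mandelstamS m p q / 4 - m ^ 2)) / (energy m p * energy m q) := by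
  rw [mollerVelocity, mandelstamS_eq_two_mul]
  congr 2
  ring

theorem mollerVelocity_nonneg : 0 ≤ mollerVelocity m p q :=
  div_nonneg (Real.sqrt_nonneg _) (mul_nonneg (energy_nonneg _ _) (energy_nonneg _ _))

theorem mollerVelocity_comm : mollerVelocity m p q = mollerVelocity m q p := by
  rw [mollerVelocity_eq, mollerVelocity_eq, mandelstamS_comm, mul_comm (energy m p)]

/-- The total energy of two particles of opposite center-of-mass momenta `± k`, seen from the frame
in which their total momentum is `P`. -/
noncomputable def pairEnergy (P k : Momentum) : ℝ := √((2 * energy m k) ^ 2 + ‖P‖ ^ 2)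

/-- The momentum of a particle of center-of-mass momentum `k` in the frame in which the total
momentum of the pair is `P`. -/
noncomputable def pairBoost (P k : Momentum) : Momentum :=
  (1 / 2 : ℝ) • P + k +
    (inner ℝ P k / (2 * energy m k * (pairEnergy m P k + 2 * energy m k))) • P

theorem pairEnergy_sq : pairEnergy m P k ^ 2 = (2 * energy m k) ^ 2 + ‖P‖ ^ 2 :=
  Real.sq_sqrt (by positivity)

theorem pairEnergy_nonneg : 0 ≤ pairEnergy m P k := Real.sqrt_nonneg _

theorem pairEnergy_pos (hk : k ≠ 0) : 0 < pairEnergy m P k :=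
  Real.sqrt_pos.2 (by have := energy_pos m hk; positivity)

theorem pairEnergy_eq_of_norm_eq {l : Momentum} (h : ‖k‖ = ‖l‖) :
    pairEnergy m P k = pairEnergy m P l := by
  rw [pairEnergy, pairEnergy, energy_eq_of_norm_eq m h]

theorem sub_pairBoost (k : Momentum) : P - pairBoost m P k = pairBoost m P (-k) := by
  rw [pairBoost, pairBoost, energy_eq_of_norm_eq m (norm_neg k),
    pairEnergy_eq_of_norm_eq m P (norm_neg k), inner_neg_right]
  module

theorem abs_inner_lt_pairEnergy_mul_energy (hk : k ≠ 0) :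
    |inner ℝ P k| < pairEnergy m P k * energy m k := by
  have hε := energy_pos m hk
  have hP : ‖P‖ < pairEnergy m P k := by
    refine lt_of_pow_lt_pow_left₀ 2 (pairEnergy_nonneg m P) ?_
    rw [pairEnergy_sq]
    exact lt_add_of_pos_left _ (by positivity)
  calc |inner ℝ P k| ≤ ‖P‖ * ‖k‖ := abs_real_inner_le_norm P k
    _ ≤ ‖P‖ * energy m k := by gcongr; exact norm_le_energy m k
    _ < pairEnergy m P k * energy m k := by gcongr

theorem pairEnergy_div_two_add_pos (hk : k ≠ 0) :
    0 < pairEnergy m P k / 2 + inner ℝ P k / (2 * energy m k) := by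
  have hε := energy_pos m hk
  have hlt := neg_lt_of_abs_lt (abs_inner_lt_pairEnergy_mul_energy m P hk)
  rw [show pairEnergy m P k / 2 + inner ℝ P k / (2 * energy m k) =
    (pairEnergy m P k * energy m k + inner ℝ P k) / (2 * energy m k) by field_simp]
  exact div_pos (by linarith) (by linarith)

theorem energy_pairBoost (hk : k ≠ 0) :
    energy m (pairBoost m P k) = pairEnergy m P k / 2 + inner ℝ P k / (2 * energy m k) := by
  have hε := energy_pos m hk
  have hE := pairEnergy_pos m P hk
  have hP : ‖P‖ ^ 2 = pairEnergy m P k ^ 2 - (2 * energy m k) ^ 2 :=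
    eq_sub_of_add_eq' (pairEnergy_sq m P).symm
  have hk' : ‖k‖ ^ 2 = energy m k ^ 2 - m ^ 2 := eq_sub_of_add_eq' (energy_sq m k).symm
  have hboost : pairBoost m P k = ((1 / 2 : ℝ) +
      inner ℝ P k / (2 * energy m k * (pairEnergy m P k + 2 * energy m k))) • P + k := by
    rw [pairBoost]
    module
  rw [← Real.sqrt_sq (pairEnergy_div_two_add_pos m P hk).le, energy, hboost, norm_add_sq_real,
    norm_smul, real_inner_smul_left, mul_pow, hP, hk', Real.norm_eq_abs, sq_abs]
  congr 1
  field_simp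
  ring

theorem energy_pairBoost_pos (hk : k ≠ 0) : 0 < energy m (pairBoost m P k) := by
  rw [energy_pairBoost m P hk]
  exact pairEnergy_div_two_add_pos m P hk

theorem energy_sub_pairBoost (hk : k ≠ 0) :
    energy m (P - pairBoost m P k) = pairEnergy m P k / 2 - inner ℝ P k / (2 * energy m k) := by
  rw [sub_pairBoost, energy_pairBoost m P (neg_ne_zero.2 hk),
    energy_eq_of_norm_eq m (norm_neg k), pairEnergy_eq_of_norm_eq m P (norm_neg k),
    inner_neg_right, neg_div, sub_eq_add_neg]

theorem energy_pairBoost_add (hk : k ≠ 0) :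
    energy m (pairBoost m P k) + energy m (P - pairBoost m P k) = pairEnergy m P k := by
  rw [energy_pairBoost m P hk, energy_sub_pairBoost m P hk]
  ring

theorem mandelstamS_pairBoost (hk : k ≠ 0) :
    mandelstamS m (pairBoost m P k) (P - pairBoost m P k) = (2 * energy m k) ^ 2 := by
  rw [mandelstamS_eq, energy_pairBoost_add m P hk, add_sub_cancel, pairEnergy_sq,
    add_sub_cancel_right]

theorem sqrt_mandelstamS_pairBoost (hk : k ≠ 0) :
    √(mandelstamS m (pairBoost m P k) (P - pairBoost m P k)) = 2 * energy m k := by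
  rw [mandelstamS_pairBoost m P hk,
    Real.sqrt_sq (mul_nonneg zero_le_two (energy_nonneg m k))]

theorem mollerVelocity_pairBoost (hk : k ≠ 0) :
    mollerVelocity m (pairBoost m P k) (P - pairBoost m P k) =
      2 * energy m k * ‖k‖ / (energy m (pairBoost m P k) * energy m (P - pairBoost m P k)) := by
  have hnonneg : 0 ≤ 2 * energy m k * ‖k‖ :=
    mul_nonneg (mul_nonneg zero_le_two (energy_nonneg m k)) (norm_nonneg k)
  rw [mollerVelocity_eq, mandelstamS_pairBoost m P hk, ← Real.sqrt_sq hnonneg]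
  congr 2
  rw [mul_pow _ ‖k‖, ← add_sub_cancel_left (m ^ 2) (‖k‖ ^ 2), ← energy_sq]
  ring

theorem outgoing_pairBoost (hk : k ≠ 0) (hω : ‖ω‖ = 1) :
    outgoing m (pairBoost m P k) (P - pairBoost m P k) ω = pairBoost m P (‖k‖ • ω) := by
  have hnorm : ‖‖k‖ • ω‖ = ‖k‖ := by rw [norm_smul, norm_norm, hω, mul_one]
  have hκ : √(mandelstamS m (pairBoost m P k) (P - pairBoost m P k) - 4 * m ^ 2) / 2 = ‖k‖ := by
    rw [mandelstamS_pairBoost m P hk, mul_pow, energy_sq,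
      show (2 : ℝ) ^ 2 * (m ^ 2 + ‖k‖ ^ 2) - 4 * m ^ 2 = (2 * ‖k‖) ^ 2 by ring,
      Real.sqrt_sq (by positivity), mul_div_cancel_left₀ _ two_ne_zero]
  rw [outgoing, hκ, sqrt_mandelstamS_pairBoost m P hk, energy_pairBoost_add m P hk,
    add_sub_cancel, pairBoost, energy_eq_of_norm_eq m hnorm, pairEnergy_eq_of_norm_eq m P hnorm,
    inner_smul_right]
  module

/-- The center-of-mass momentum of a particle of momentum `p` in a pair of momenta `p`, `q`: the
inverse of `pairBoost` at total momentum `p + q`. -/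
noncomputable def centerOfMassMomentum (p q : Momentum) : Momentum :=
  (1 / 2 : ℝ) • (p - q - ((energy m p - energy m q) /
    (energy m p + energy m q + √(mandelstamS m p q))) • (p + q))

theorem centerOfMassMomentum_pairBoost (hk : k ≠ 0) :
    centerOfMassMomentum m (pairBoost m P k) (P - pairBoost m P k) = k := by
  have hε := energy_pos m hk
  have hE := pairEnergy_pos m P hk
  have hdiff : energy m (pairBoost m P k) - energy m (P - pairBoost m P k) =
      inner ℝ P k / energy m k := by
    rw [energy_pairBoost m P hk, energy_sub_pairBoost m P hk]
    field_simp
    ring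
  have hcoeff : inner ℝ P k / energy m k / (pairEnergy m P k + 2 * energy m k) =
      2 * (inner ℝ P k / (2 * energy m k * (pairEnergy m P k + 2 * energy m k))) := by
    field_simp
  rw [centerOfMassMomentum, hdiff, energy_pairBoost_add m P hk, sqrt_mandelstamS_pairBoost m P hk,
    hcoeff, add_sub_cancel, pairBoost]
  module

theorem injOn_pairBoost : Set.InjOn (pairBoost m P) {0}ᶜ := by
  intro k hk l hl h
  rw [← centerOfMassMomentum_pairBoost m P hk, h, centerOfMassMomentum_pairBoost m P hl]

theorem inner_add_sub_eq_energy :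
    inner ℝ (p + q) (p - q) = (energy m p + energy m q) * (energy m p - energy m q) := by
  rw [inner_add_left, inner_sub_right, inner_sub_right, real_inner_comm p q,
    real_inner_self_eq_norm_sq, real_inner_self_eq_norm_sq]
  linarith [energy_sq m p, energy_sq m q]

theorem norm_sub_sq_eq_energy :
    ‖p - q‖ ^ 2 = mandelstamS m p q - 4 * m ^ 2 + (energy m p - energy m q) ^ 2 := by
  rw [mandelstamS_eq, norm_sub_sq_real, norm_add_sq_real]
  linarith [energy_sq m p, energy_sq m q]

theorem norm_add_sq_eq_energy :
    ‖p + q‖ ^ 2 = (energy m p + energy m q) ^ 2 - √(mandelstamS m p q) ^ 2 := by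
  rw [Real.sq_sqrt (mandelstamS_nonneg m p q), mandelstamS_eq, sub_sub_cancel]

variable {p q m} (hs : 0 < mandelstamS m p q)

include hs

theorem energy_add_sqrt_mandelstamS_pos :
    0 < energy m p + energy m q + √(mandelstamS m p q) :=
  add_pos_of_nonneg_of_pos (add_nonneg (energy_nonneg m p) (energy_nonneg m q)) (Real.sqrt_pos.2 hs)

theorem norm_centerOfMassMomentum_sq :
    ‖centerOfMassMomentum m p q‖ ^ 2 = mandelstamS m p q / 4 - m ^ 2 := by
  have hsum := energy_add_sqrt_mandelstamS_pos hs
  rw [centerOfMassMomentum, norm_smul, mul_pow, norm_sub_sq_real, inner_smul_right, norm_smul,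
    mul_pow, real_inner_comm, inner_add_sub_eq_energy m, norm_sub_sq_eq_energy m,
    norm_add_sq_eq_energy m, Real.norm_eq_abs, Real.norm_eq_abs, sq_abs, sq_abs]
  field_simp
  ring

theorem two_mul_energy_centerOfMassMomentum :
    2 * energy m (centerOfMassMomentum m p q) = √(mandelstamS m p q) := by
  rw [energy, norm_centerOfMassMomentum_sq hs, add_sub_cancel,
    show mandelstamS m p q / 4 = mandelstamS m p q / 2 ^ 2 by norm_num,
    Real.sqrt_div (mandelstamS_nonneg m p q), Real.sqrt_sq zero_le_two,
    mul_div_cancel₀ _ two_ne_zero]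

theorem pairEnergy_centerOfMassMomentum :
    pairEnergy m (p + q) (centerOfMassMomentum m p q) = energy m p + energy m q := by
  rw [pairEnergy, two_mul_energy_centerOfMassMomentum hs, norm_add_sq_eq_energy m, add_sub_cancel,
    Real.sqrt_sq (add_nonneg (energy_nonneg m p) (energy_nonneg m q))]

theorem inner_add_centerOfMassMomentum :
    inner ℝ (p + q) (centerOfMassMomentum m p q) =
      (energy m p - energy m q) * √(mandelstamS m p q) / 2 := by
  have hsum := energy_add_sqrt_mandelstamS_pos hs
  rw [centerOfMassMomentum, inner_smul_right, inner_sub_right, inner_smul_right,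
    inner_add_sub_eq_energy m, real_inner_self_eq_norm_sq, norm_add_sq_eq_energy m]
  field_simp
  ring

theorem pairBoost_centerOfMassMomentum :
    pairBoost m (p + q) (centerOfMassMomentum m p q) = p := by
  have hsum := energy_add_sqrt_mandelstamS_pos hs
  have := Real.sqrt_pos.2 hs
  rw [pairBoost, two_mul_energy_centerOfMassMomentum hs, pairEnergy_centerOfMassMomentum hs,
    inner_add_centerOfMassMomentum hs,
    show (energy m p - energy m q) * √(mandelstamS m p q) / 2 /
      (√(mandelstamS m p q) * (energy m p + energy m q + √(mandelstamS m p q))) =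
      (1 / 2) * ((energy m p - energy m q) / (energy m p + energy m q + √(mandelstamS m p q))) by
        field_simp,
    centerOfMassMomentum]
  module

omit hs in
theorem exists_pairBoost_eq (h : mollerVelocity m p q ≠ 0) :
    ∃ k : Momentum, k ≠ 0 ∧ pairBoost m (p + q) k = p := by
  have hpos : 0 < mandelstamS m p q * (mandelstamS m p q / 4 - m ^ 2) := by
    by_contra! hle
    exact h (by rw [mollerVelocity_eq, Real.sqrt_eq_zero_of_nonpos hle, zero_div])
  have hs : 0 < mandelstamS m p q :=
    (mandelstamS_nonneg m p q).lt_of_ne' (left_ne_zero_of_mul hpos.ne')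
  refine ⟨centerOfMassMomentum m p q, fun h0 => ?_, pairBoost_centerOfMassMomentum hs⟩
  have hκ := norm_centerOfMassMomentum_sq hs
  rw [h0, norm_zero, zero_pow two_ne_zero] at hκ
  exact hpos.ne' (by rw [← hκ, mul_zero])

end Kinematics

section Measurability

variable {X : Type*} [MeasurableSpace X] (m : ℝ)

@[fun_prop]
theorem measurable_energy : Measurable (energy m) := by
  unfold energy
  fun_prop

@[fun_prop]
theorem measurable_minkowski {a b : X → Fin 4 → ℝ} (ha : Measurable a) (hb : Measurable b) :
    Measurable fun x => minkowski (a x) (b x) := by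
  unfold minkowski
  fun_prop

@[fun_prop]
theorem measurable_fourMomentum : Measurable (fourMomentum m) := by
  refine measurable_pi_lambda _ (Fin.cases ?_ fun j => ?_) <;>
    simp only [fourMomentum, Fin.cons_zero, Fin.cons_succ] <;> fun_prop

variable {p q ω : X → Momentum}

@[fun_prop]
theorem measurable_mandelstamS (hp : Measurable p) (hq : Measurable q) :
    Measurable fun x => mandelstamS m (p x) (q x) := by
  unfold mandelstamS
  fun_prop

@[fun_prop]
theorem measurable_mollerVelocity (hp : Measurable p) (hq : Measurable q) :
    Measurable fun x => mollerVelocity m (p x) (q x) := by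
  unfold mollerVelocity
  fun_prop

@[fun_prop]
theorem measurable_outgoing (hp : Measurable p) (hq : Measurable q) (hω : Measurable ω) :
    Measurable fun x => outgoing m (p x) (q x) (ω x) := by
  unfold outgoing
  fun_prop

@[fun_prop]
theorem measurable_pairEnergy (P : Momentum) : Measurable (pairEnergy m P) := by
  unfold pairEnergy
  fun_prop

@[fun_prop]
theorem measurable_pairBoost (P : Momentum) : Measurable (pairBoost m P) := by
  unfold pairBoost
  fun_prop

end Measurability

section Jacobian

variable (m : ℝ) (P : Momentum) {k : Momentum}

theorem hasDerivAt_boostCoefficient (b : ℝ) {t : ℝ} (ht : 0 < t) :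
    HasDerivAt (fun t => (2 * √t * (√((2 * √t) ^ 2 + b ^ 2) + 2 * √t))⁻¹)
      (-2 / (√((2 * √t) ^ 2 + b ^ 2) * (2 * √t) ^ 3)) t := by
  have hs := Real.sqrt_pos.2 ht
  have hpos : 0 < (2 * √t) ^ 2 + b ^ 2 := by positivity
  have hE := Real.sqrt_pos.2 hpos
  have hw : HasDerivAt (fun t : ℝ => 2 * √t) (2 * (1 / (2 * √t))) t :=
    (Real.hasDerivAt_sqrt ht.ne').const_mul 2
  have hE' := ((hw.pow 2).add_const (b ^ 2)).sqrt hpos.ne'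
  have hne : 2 * √t * (√((2 * √t) ^ 2 + b ^ 2) + 2 * √t) ≠ 0 := by positivity
  refine ((hw.mul (hE'.add hw)).inv hne).congr_deriv ?_
  simp only [Pi.mul_apply, Pi.add_apply, Pi.pow_apply]
  set W := √t
  set E := √((2 * W) ^ 2 + b ^ 2)
  have hsum : E + 2 * W ≠ 0 := by positivity
  field_simp
  ring

/-- The functional `ξ` for which the derivative of `pairBoost m P` at `k` is `v ↦ v + ξ v • P`. -/
noncomputable def pairBoostDual (k : Momentum) : Momentum →L[ℝ] ℝ :=
  (2 * energy m k * (pairEnergy m P k + 2 * energy m k))⁻¹ • innerSL ℝ P +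
    (inner ℝ P k * (-4 / (pairEnergy m P k * (2 * energy m k) ^ 3))) • innerSL ℝ k

theorem hasFDerivAt_pairBoost (hk : k ≠ 0) :
    HasFDerivAt (pairBoost m P)
      (ContinuousLinearMap.id ℝ Momentum + (pairBoostDual m P k).smulRight P) k := by
  have ht : 0 < m ^ 2 + ‖k‖ ^ 2 := by have := norm_pos_iff.2 hk; positivity
  have hnorm : HasFDerivAt (fun k : Momentum => m ^ 2 + ‖k‖ ^ 2) (2 • innerSL ℝ k) k :=
    (hasStrictFDerivAt_norm_sq k).hasFDerivAt.const_add (m ^ 2)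
  have hcoeff := (hasDerivAt_boostCoefficient ‖P‖ ht).comp_hasFDerivAt k hnorm
  have hinner : HasFDerivAt (fun k : Momentum => (inner ℝ P k : ℝ)) (innerSL ℝ P) k :=
    (innerSL ℝ P).hasFDerivAt
  refine (((hasFDerivAt_id k).const_add ((1 / 2 : ℝ) • P)).add
    ((hinner.mul hcoeff).smul_const P)).congr_fderiv ?_
  ext v : 1
  simp only [pairBoostDual, pairEnergy, energy, add_apply, smul_apply,
    ContinuousLinearMap.smulRight_apply, Function.comp_apply, smul_eq_mul, nsmul_eq_mul]
  congr 2
  push_cast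
  ring

theorem det_fderiv_pairBoost (hk : k ≠ 0) :
    (ContinuousLinearMap.id ℝ Momentum + (pairBoostDual m P k).smulRight P).det =
      4 * (energy m (pairBoost m P k) * energy m (P - pairBoost m P k)) /
        (pairEnergy m P k * (2 * energy m k)) := by
  have hε := energy_pos m hk
  have hE := pairEnergy_pos m P hk
  have hP : ‖P‖ ^ 2 = pairEnergy m P k ^ 2 - (2 * energy m k) ^ 2 :=
    eq_sub_of_add_eq' (pairEnergy_sq m P).symm
  have hsum : pairEnergy m P k + 2 * energy m k ≠ 0 := by positivity
  calc (ContinuousLinearMap.id ℝ Momentum + (pairBoostDual m P k).smulRight P).det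
      = 1 + pairBoostDual m P k P :=
        LinearMap.transvection.det (pairBoostDual m P k : Momentum →ₗ[ℝ] ℝ) P
    _ = _ := by
      rw [energy_pairBoost m P hk, energy_sub_pairBoost m P hk]
      simp only [pairBoostDual, add_apply, smul_apply, innerSL_apply_apply, smul_eq_mul,
        real_inner_self_eq_norm_sq, real_inner_comm P k, hP]
      field_simp
      ring

theorem abs_det_fderiv_pairBoost_mul_mollerVelocity (hk : k ≠ 0) :
    |(ContinuousLinearMap.id ℝ Momentum + (pairBoostDual m P k).smulRight P).det| *
      mollerVelocity m (pairBoost m P k) (P - pairBoost m P k) = 4 * ‖k‖ / pairEnergy m P k := by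
  have hε := energy_pos m hk
  have hE := pairEnergy_pos m P hk
  have hp := energy_pairBoost_pos m P hk
  have hq := energy_pairBoost_pos m P (neg_ne_zero.2 hk)
  rw [← sub_pairBoost] at hq
  rw [det_fderiv_pairBoost m P hk, mollerVelocity_pairBoost m P hk, abs_of_nonneg (by positivity)]
  field_simp

theorem image_pairBoost :
    pairBoost m P '' {0}ᶜ = {p | mollerVelocity m p (P - p) ≠ 0} := by
  ext p
  constructor
  · rintro ⟨k, hk, rfl⟩
    have hk : k ≠ 0 := hk
    have hε := energy_pos m hk
    have hp := energy_pairBoost_pos m P hk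
    have hq := energy_pairBoost_pos m P (neg_ne_zero.2 hk)
    rw [Set.mem_ofPred_eq, mollerVelocity_pairBoost m P hk, sub_pairBoost]
    have := norm_pos_iff.2 hk
    positivity
  · intro hp
    obtain ⟨k, hk, h⟩ := exists_pairBoost_eq hp
    rw [add_sub_cancel] at h
    exact ⟨k, hk, h⟩

theorem lintegral_mollerVelocity_mul (F : Momentum → ℝ≥0∞) :
    ∫⁻ p, ENNReal.ofReal (mollerVelocity m p (P - p)) * F p =
      ∫⁻ k, ENNReal.ofReal (4 * ‖k‖ / pairEnergy m P k) * F (pairBoost m P k) := by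
  have h0 : MeasurableSet ({0}ᶜ : Set Momentum) := (measurableSet_singleton 0).compl
  have hsupport : Function.support (fun p => ENNReal.ofReal (mollerVelocity m p (P - p)) * F p) ⊆
      pairBoost m P '' {0}ᶜ := by
    rw [image_pairBoost]
    intro p hp h
    exact hp (by simp only [h, ENNReal.ofReal_zero, zero_mul])
  calc ∫⁻ p, ENNReal.ofReal (mollerVelocity m p (P - p)) * F p
      = ∫⁻ p in pairBoost m P '' {0}ᶜ, ENNReal.ofReal (mollerVelocity m p (P - p)) * F p :=
        (setLIntegral_eq_of_support_subset hsupport).symm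
    _ = ∫⁻ k in {0}ᶜ, ENNReal.ofReal |(ContinuousLinearMap.id ℝ Momentum +
          (pairBoostDual m P k).smulRight P).det| *
          (ENNReal.ofReal (mollerVelocity m (pairBoost m P k) (P - pairBoost m P k)) *
            F (pairBoost m P k)) :=
        lintegral_image_eq_lintegral_abs_det_fderiv_mul volume h0
          (fun k hk => (hasFDerivAt_pairBoost m P hk).hasFDerivWithinAt) (injOn_pairBoost m P) _
    _ = ∫⁻ k in {0}ᶜ, ENNReal.ofReal (4 * ‖k‖ / pairEnergy m P k) * F (pairBoost m P k) :=
        setLIntegral_congr_fun h0 fun k hk => by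
          rw [← mul_assoc, ← ENNReal.ofReal_mul (abs_nonneg _),
            abs_det_fderiv_pairBoost_mul_mollerVelocity m P hk]
    _ = _ := by rw [restrict_compl_singleton]

end Jacobian

section PolarCoordinates

open Metric

variable {E : Type*} [NormedAddCommGroup E] [NormedSpace ℝ E] [MeasurableSpace E] [BorelSpace E]
  (μ : Measure E)

section Polar

variable [FiniteDimensional ℝ E] [Nontrivial E] [μ.IsAddHaarMeasure]

theorem lintegral_eq_lintegral_volumeIoiPow_toSphere {F : E → ℝ≥0∞} (hF : Measurable F) :
    ∫⁻ x, F x ∂μ = ∫⁻ r : Set.Ioi (0 : ℝ), ∫⁻ ω : sphere (0 : E) 1, F ((r : ℝ) • (ω : E))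
      ∂μ.toSphere ∂Measure.volumeIoiPow (Module.finrank ℝ E - 1) := by
  have hpolar : Measurable fun z : sphere (0 : E) 1 × Set.Ioi (0 : ℝ) =>
      F ((z.2 : ℝ) • (z.1 : E)) := by fun_prop
  calc ∫⁻ x, F x ∂μ = ∫⁻ x : ({0}ᶜ : Set E), F x ∂(μ.comap Subtype.val) := by
        rw [lintegral_subtype_comap (measurableSet_singleton _).compl, restrict_compl_singleton]
    _ = ∫⁻ x, (fun z : sphere (0 : E) 1 × Set.Ioi (0 : ℝ) => F ((z.2 : ℝ) • (z.1 : E)))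
          (homeomorphUnitSphereProd E x) ∂(μ.comap Subtype.val) := by
        refine lintegral_congr fun x => ?_
        simp [smul_smul, norm_ne_zero_iff.2 x.2]
    _ = ∫⁻ z, F ((z.2 : ℝ) • (z.1 : E))
          ∂(μ.toSphere.prod (Measure.volumeIoiPow (Module.finrank ℝ E - 1))) :=
        μ.measurePreserving_homeomorphUnitSphereProd.lintegral_comp hpolar
    _ = _ := lintegral_prod_symm' _ hpolar

theorem lintegral_lintegral_toSphere_swap {K : E × E → ℝ≥0∞} (hK : Measurable K) :
    ∫⁻ x, ∫⁻ ω : sphere (0 : E) 1, K (x, ‖x‖ • (ω : E)) ∂μ.toSphere ∂μ =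
      ∫⁻ x, ∫⁻ ω : sphere (0 : E) 1, K (‖x‖ • (ω : E), x) ∂μ.toSphere ∂μ := by
  have hleft : Measurable fun z : E × sphere (0 : E) 1 => K (z.1, ‖z.1‖ • (z.2 : E)) := by
    fun_prop
  have hright : Measurable fun z : E × sphere (0 : E) 1 => K (‖z.1‖ • (z.2 : E), z.1) := by
    fun_prop
  have hnorm (r : Set.Ioi (0 : ℝ)) (ω : sphere (0 : E) 1) : ‖(r : ℝ) • (ω : E)‖ = r := by
    rw [norm_smul, norm_eq_of_mem_sphere, mul_one, Real.norm_of_nonneg (le_of_lt r.2)]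
  rw [lintegral_eq_lintegral_volumeIoiPow_toSphere μ hleft.lintegral_prod_right',
    lintegral_eq_lintegral_volumeIoiPow_toSphere μ hright.lintegral_prod_right']
  simp only [hnorm]
  exact lintegral_congr fun r => lintegral_lintegral_swap (by fun_prop)

end Polar

open scoped Pointwise in
instance isNegInvariant_toSphere [μ.IsNegInvariant] : μ.toSphere.IsNegInvariant where
  neg_eq_self := by
    ext s hs
    rw [Measure.neg_apply, Measure.toSphere_apply' _ hs.neg, Measure.toSphere_apply' _ hs,
      ← Measure.measure_neg μ (Set.Ioo (0 : ℝ) 1 • ((↑) '' s : Set E))]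
    congr 2
    ext x
    simp only [Set.mem_smul, Set.mem_image, Set.mem_neg]
    constructor
    · rintro ⟨r, hr, _, ⟨ω, hω, rfl⟩, rfl⟩
      exact ⟨r, hr, _, ⟨-ω, hω, rfl⟩, by simp⟩
    · rintro ⟨r, hr, _, ⟨ω, hω, rfl⟩, h⟩
      exact ⟨r, hr, _, ⟨-ω, by simpa using hω, rfl⟩, by simp [h]⟩

end PolarCoordinates

section ElasticCollision

variable (m : ℝ)

/-- The solid-angle measure `dΩ` on the scattering directions. -/
noncomputable abbrev solidAngle : Measure Direction := (volume : Measure Momentum).toSphere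

instance sFinite_solidAngle : SFinite solidAngle := inferInstance

/-- The incoming and outgoing momenta `((p, q), (p', q'))` of a binary collision. -/
abbrev Collision : Type := (Momentum × Momentum) × Momentum × Momentum

/-- The elastic collision of `p` and `q` with scattering direction `Ω`. -/
noncomputable def collide (x : Momentum × Momentum × Direction) : Collision :=
  ((x.1, x.2.1), outgoing m x.1 x.2.1 x.2.2, outgoingPartner m x.1 x.2.1 x.2.2)

/-- The momenta of the two particles of center-of-mass momenta `± k` in the frame in which their
total momentum is `P`. -/
noncomputable def boostedPair (P k : Momentum) : Momentum × Momentum :=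
  (pairBoost m P k, P - pairBoost m P k)

@[fun_prop]
theorem measurable_collide : Measurable (collide m) := by
  unfold collide outgoingPartner
  fun_prop

@[fun_prop]
theorem measurable_boostedPair (P : Momentum) : Measurable (boostedPair m P) := by
  unfold boostedPair
  fun_prop

theorem norm_norm_smul_direction (k : Momentum) (Ω : Direction) :
    ‖‖k‖ • (Ω : Momentum)‖ = ‖k‖ := by
  rw [norm_smul, norm_norm, norm_eq_of_mem_sphere, mul_one]

theorem collide_boostedPair (P : Momentum) {k : Momentum} (hk : k ≠ 0) (Ω : Direction) :
    collide m ((boostedPair m P k).1, (boostedPair m P k).2, Ω) =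
      (boostedPair m P k, boostedPair m P (‖k‖ • (Ω : Momentum))) := by
  simp only [collide, boostedPair, outgoingPartner, outgoing_pairBoost m P hk
    (norm_eq_of_mem_sphere Ω), add_sub_cancel]

theorem lintegral_collide {F : Collision → ℝ≥0∞} (hF : Measurable F) :
    ∫⁻ p, ∫⁻ q, ∫⁻ Ω, ENNReal.ofReal (mollerVelocity m p q) * F (collide m (p, q, Ω)) ∂solidAngle =
      ∫⁻ P, ∫⁻ k, ∫⁻ Ω : Direction, ENNReal.ofReal (4 * ‖k‖ / pairEnergy m P k) *
        F (boostedPair m P k, boostedPair m P (‖k‖ • (Ω : Momentum))) ∂solidAngle := by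
  simp only [lintegral_const_mul' _ _ ENNReal.ofReal_ne_top]
  set Φ : Momentum → Momentum → ℝ≥0∞ := fun p q => ∫⁻ Ω, F (collide m (p, q, Ω)) ∂solidAngle
  have : Measurable fun z : Momentum × Momentum => Φ z.1 (z.2 - z.1) := by
    have hcollide : Measurable fun w : (Momentum × Momentum) × Direction =>
        F (collide m (w.1.1, w.1.2 - w.1.1, w.2)) := by fun_prop
    exact hcollide.lintegral_prod_right'
  calc ∫⁻ p, ∫⁻ q, ENNReal.ofReal (mollerVelocity m p q) * Φ p q
      = ∫⁻ p, ∫⁻ P, ENNReal.ofReal (mollerVelocity m p (P - p)) * Φ p (P - p) :=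
        lintegral_congr fun p => (lintegral_sub_right_eq_self
          (fun q => ENNReal.ofReal (mollerVelocity m p q) * Φ p q) p).symm
    _ = ∫⁻ P, ∫⁻ p, ENNReal.ofReal (mollerVelocity m p (P - p)) * Φ p (P - p) :=
        lintegral_lintegral_swap (by fun_prop)
    _ = ∫⁻ P, ∫⁻ k, ENNReal.ofReal (4 * ‖k‖ / pairEnergy m P k) *
          Φ (boostedPair m P k).1 (boostedPair m P k).2 :=
        lintegral_congr fun P => lintegral_mollerVelocity_mul m P fun p => Φ p (P - p)
    _ = _ := by
        refine lintegral_congr fun P => lintegral_congr fun k => ?_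
        rcases eq_or_ne k 0 with rfl | hk
        · simp
        · simp only [Φ, collide_boostedPair m P hk]

theorem lintegral_collide_swap {F : Collision → ℝ≥0∞} (hF : Measurable F) :
    ∫⁻ p, ∫⁻ q, ∫⁻ Ω, ENNReal.ofReal (mollerVelocity m p q) *
        F (collide m (p, q, Ω)).swap ∂solidAngle =
      ∫⁻ p, ∫⁻ q, ∫⁻ Ω, ENNReal.ofReal (mollerVelocity m p q) *
        F (collide m (p, q, Ω)) ∂solidAngle := by
  rw [lintegral_collide m (F := fun y => F y.swap) (by fun_prop), lintegral_collide m hF]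
  refine lintegral_congr fun P => ?_
  let K : Momentum × Momentum → ℝ≥0∞ := fun z =>
    ENNReal.ofReal (4 * ‖z.1‖ / pairEnergy m P z.1) *
      F (boostedPair m P z.2, boostedPair m P z.1)
  have hK : Measurable K := by fun_prop
  refine (lintegral_lintegral_toSphere_swap volume hK).trans
    (lintegral_congr fun k => lintegral_congr fun Ω => ?_)
  simp only [K, norm_norm_smul_direction,
    pairEnergy_eq_of_norm_eq m P (norm_norm_smul_direction k Ω)]

variable {m} {p q : Momentum}

theorem exists_collide_eq_boostedPair (h : mollerVelocity m p q ≠ 0) (Ω : Direction) :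
    ∃ k ≠ 0, collide m (p, q, Ω) =
      (boostedPair m (p + q) k, boostedPair m (p + q) (‖k‖ • (Ω : Momentum))) := by
  obtain ⟨k, hk, hkp⟩ := exists_pairBoost_eq h
  have hpq : boostedPair m (p + q) k = (p, q) := by
    rw [boostedPair, hkp, add_sub_cancel_left]
  have := collide_boostedPair m (p + q) hk Ω
  rw [hpq] at this
  exact ⟨k, hk, by rw [this, hpq]⟩

theorem energy_outgoing_add (h : mollerVelocity m p q ≠ 0) (Ω : Direction) :
    energy m (outgoing m p q Ω) + energy m (outgoingPartner m p q Ω) =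
      energy m p + energy m q := by
  obtain ⟨k, hk, heq⟩ := exists_collide_eq_boostedPair h Ω
  have hkΩ := norm_norm_smul_direction k Ω
  have hkΩ0 : ‖k‖ • (Ω : Momentum) ≠ 0 := by rwa [← norm_ne_zero_iff, hkΩ, norm_ne_zero_iff]
  simp only [collide, boostedPair, Prod.mk.injEq] at heq
  obtain ⟨⟨hp, hq⟩, hp', hq'⟩ := heq
  rw [hp', hq', energy_pairBoost_add m _ hkΩ0, pairEnergy_eq_of_norm_eq m _ hkΩ,
    ← energy_pairBoost_add m _ hk, ← hq, ← hp]

theorem fourMomentum_outgoing_add (h : mollerVelocity m p q ≠ 0) (Ω : Direction) :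
    fourMomentum m (outgoing m p q Ω) + fourMomentum m (outgoingPartner m p q Ω) =
      fourMomentum m p + fourMomentum m q := by
  funext μ
  refine Fin.cases ?_ (fun j => ?_) μ
  · simpa [fourMomentum] using energy_outgoing_add h Ω
  · simp [fourMomentum, outgoingPartner]

variable (m p q)

theorem collide_neg (Ω : Direction) :
    collide m (q, p, -Ω) = Prod.map Prod.swap Prod.swap (collide m (p, q, Ω)) := by
  have hout : outgoing m q p (-Ω) = outgoingPartner m p q Ω := by
    rw [outgoingPartner, outgoing, outgoing, mandelstamS_comm m q p, add_comm q p,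
      add_comm (energy m q), inner_neg_right]
    module
  simp [collide, hout, outgoingPartner, add_comm q p]

end ElasticCollision

namespace Gas

variable (G : Gas)

theorem feq_pos (p : Momentum) : 0 < G.feq p := Real.exp_pos _

theorem feq_mul_feq (p q : Momentum) : G.feq p * G.feq q =
    Real.exp (2 * G.α + minkowski (Fin.cons G.β₀ fun j => G.β j)
      (fourMomentum G.mass p + fourMomentum G.mass q)) := by
  rw [feq, feq, ← Real.exp_add]
  simp only [minkowski, Pi.add_apply, mul_add, Finset.sum_add_distrib]
  ring_nf

@[fun_prop]
theorem measurable_feq : Measurable G.feq := by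
  unfold feq
  fun_prop

/-- The density `f_eq / (2π)³` of the measure of the gas with respect to `d³p`. -/
noncomputable def density (p : Momentum) : ℝ≥0∞ := ENNReal.ofReal (G.feq p / (2 * Real.pi) ^ 3)

@[fun_prop]
theorem measurable_density : Measurable G.density := by
  unfold density
  fun_prop

theorem density_mul_density (p q : Momentum) : G.density p * G.density q =
    ENNReal.ofReal (G.feq p * G.feq q / (2 * Real.pi) ^ 6) := by
  rw [density, density, ← ENNReal.ofReal_mul (div_nonneg (G.feq_pos p).le (by positivity)),
    div_mul_div_comm]
  norm_num [← pow_add]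

instance sigmaFinite_measure : SigmaFinite G.measure :=
  SigmaFinite.withDensity_ofReal fun p => G.feq p / (2 * Real.pi) ^ 3

instance sFinite_partnerMeasure : SFinite G.partnerMeasure := by
  unfold partnerMeasure
  infer_instance

theorem measure_prod_partnerMeasure :
    G.measure.prod G.partnerMeasure = (volume.prod (volume.prod solidAngle)).withDensity
      fun x => G.density x.1 * G.density x.2.1 := by
  have hdensity := G.measurable_density
  have hpartner : G.partnerMeasure =
      (volume.prod solidAngle).withDensity fun z => G.density z.1 :=
    prod_withDensity_left hdensity
  rw [hpartner]
  exact prod_withDensity hdensity (by fun_prop)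

theorem rate_nonneg (p : Momentum) (z : Momentum × Direction) : 0 ≤ G.rate p z :=
  div_nonneg (mul_nonneg (mollerVelocity_nonneg _ _ _) (NNReal.coe_nonneg _)) zero_le_two

/-- Half the cross section, as a function of the incoming and outgoing momenta. -/
noncomputable def crossSectionOf (y : Collision) : ℝ≥0∞ :=
  ENNReal.ofReal (G.crossSection (mandelstamS G.mass y.1.1 y.1.2)
    (minkowski (fourMomentum G.mass y.1.1 - fourMomentum G.mass y.1.2)
      (fourMomentum G.mass y.2.1 - fourMomentum G.mass y.2.2)
    / (mandelstamS G.mass y.1.1 y.1.2 - 4 * G.mass ^ 2)) / 2)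

@[fun_prop]
theorem measurable_crossSectionOf : Measurable G.crossSectionOf := by
  have hσ := G.measurable_crossSection
  unfold crossSectionOf
  fun_prop

theorem crossSectionOf_swap {y : Collision}
    (h : fourMomentum G.mass y.2.1 + fourMomentum G.mass y.2.2 =
      fourMomentum G.mass y.1.1 + fourMomentum G.mass y.1.2) :
    G.crossSectionOf y.swap = G.crossSectionOf y := by
  simp only [crossSectionOf, Prod.fst_swap, Prod.snd_swap, mandelstamS, h]
  simp only [minkowski, Pi.sub_apply, mul_comm]

theorem crossSectionOf_map_swap (y : Collision) :
    G.crossSectionOf (Prod.map Prod.swap Prod.swap y) = G.crossSectionOf y := by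
  simp only [crossSectionOf, Prod.map_fst, Prod.map_snd, Prod.fst_swap, Prod.snd_swap,
    mandelstamS_comm G.mass y.1.2]
  rw [← neg_sub (fourMomentum G.mass y.1.1), ← neg_sub (fourMomentum G.mass y.2.1)]
  simp only [minkowski, Pi.neg_apply, neg_mul_neg]

theorem ofReal_rate (p q : Momentum) (Ω : Direction) :
    ENNReal.ofReal (G.rate p (q, Ω)) =
      ENNReal.ofReal (mollerVelocity G.mass p q) *
        G.crossSectionOf (collide G.mass (p, q, Ω)) := by
  rw [rate, crossSectionOf, ← ENNReal.ofReal_mul (mollerVelocity_nonneg _ _ _), ← mul_div_assoc]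
  rfl

@[fun_prop]
theorem measurable_ofReal_rate :
    Measurable fun x : Momentum × Momentum × Direction => ENNReal.ofReal (G.rate x.1 x.2) := by
  have hrate (x : Momentum × Momentum × Direction) : ENNReal.ofReal (G.rate x.1 x.2) =
      ENNReal.ofReal (mollerVelocity G.mass x.1 x.2.1) *
        G.crossSectionOf (collide G.mass x) := G.ofReal_rate x.1 x.2.1 x.2.2
  simp only [hrate]
  fun_prop

theorem fourMomentum_outgoing_add_of_rate_ne_zero {p : Momentum} {z : Momentum × Direction}
    (h : G.rate p z ≠ 0) :
    fourMomentum G.mass (outgoing G.mass p z.1 z.2) +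
      fourMomentum G.mass (outgoingPartner G.mass p z.1 z.2) =
        fourMomentum G.mass p + fourMomentum G.mass z.1 :=
  fourMomentum_outgoing_add (left_ne_zero_of_mul (left_ne_zero_of_mul h)) z.2

/-- The distribution of the incoming and outgoing momenta of the collisions in equilibrium. -/
noncomputable def collisionMeasure : Measure Collision :=
  ((G.measure.prod G.partnerMeasure).withDensity fun x => ENNReal.ofReal (G.rate x.1 x.2)).map
    (collide G.mass)

variable {G} in
theorem lintegral_collisionMeasure {F : Collision → ℝ≥0∞} (hF : Measurable F) :
    ∫⁻ y, F y ∂G.collisionMeasure =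
      ∫⁻ x, ENNReal.ofReal (G.rate x.1 x.2) * F (collide G.mass x)
        ∂(G.measure.prod G.partnerMeasure) := by
  rw [collisionMeasure, lintegral_map hF (measurable_collide _),
    lintegral_withDensity_eq_lintegral_mul _ G.measurable_ofReal_rate (by fun_prop)]
  rfl

variable {G} in
theorem lintegral_collisionMeasure_eq_lintegral_mollerVelocity {F : Collision → ℝ≥0∞}
    (hF : Measurable F) :
    ∫⁻ y, F y ∂G.collisionMeasure =
      ∫⁻ p, ∫⁻ q, ∫⁻ Ω, ENNReal.ofReal (mollerVelocity G.mass p q) *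
        (G.density p * G.density q * G.crossSectionOf (collide G.mass (p, q, Ω)) *
          F (collide G.mass (p, q, Ω))) ∂solidAngle := by
  rw [lintegral_collisionMeasure hF, measure_prod_partnerMeasure,
    lintegral_withDensity_eq_lintegral_mul _ (by fun_prop) (by fun_prop),
    lintegral_prod _ (by fun_prop)]
  refine lintegral_congr fun p => ?_
  rw [lintegral_prod _ (by fun_prop)]
  refine lintegral_congr fun q => lintegral_congr fun Ω => ?_
  rw [Pi.mul_apply, ofReal_rate]
  ring

theorem measurePreserving_swap :
    MeasurePreserving Prod.swap G.collisionMeasure G.collisionMeasure := by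
  refine ⟨measurable_swap, Measure.ext_of_lintegral _ fun F hF => ?_⟩
  rw [lintegral_map hF measurable_swap,
    lintegral_collisionMeasure_eq_lintegral_mollerVelocity (F := fun y => F y.swap) (by fun_prop),
    lintegral_collisionMeasure_eq_lintegral_mollerVelocity hF]
  refine Eq.trans ?_ (lintegral_collide_swap G.mass
    (F := fun y => G.density y.1.1 * G.density y.1.2 * G.crossSectionOf y * F y) (by fun_prop))
  refine lintegral_congr fun p => lintegral_congr fun q => lintegral_congr fun Ω => ?_
  by_cases h : mollerVelocity G.mass p q = 0
  · rw [h, ENNReal.ofReal_zero, zero_mul, zero_mul]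
  · have hcons := fourMomentum_outgoing_add h Ω
    rw [G.crossSectionOf_swap (y := collide G.mass (p, q, Ω)) hcons]
    simp only [density_mul_density, feq_mul_feq, collide, Prod.fst_swap, hcons]

theorem measurePreserving_swap_particles :
    MeasurePreserving (fun x : Momentum × Momentum × Direction => (x.2.1, x.1, -x.2.2))
      (G.measure.prod G.partnerMeasure) (G.measure.prod G.partnerMeasure) :=
  ((measurePreserving_prodAssoc _ _ _).comp
    (Measure.measurePreserving_swap.prod (Measure.measurePreserving_neg solidAngle))).comp
    (measurePreserving_prodAssoc G.measure G.measure solidAngle).symm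

theorem rate_neg (p q : Momentum) (Ω : Direction) :
    ENNReal.ofReal (G.rate q (p, -Ω)) = ENNReal.ofReal (G.rate p (q, Ω)) := by
  rw [ofReal_rate, ofReal_rate, collide_neg, crossSectionOf_map_swap, mollerVelocity_comm]

theorem measurePreserving_map_swap :
    MeasurePreserving (Prod.map Prod.swap Prod.swap) G.collisionMeasure G.collisionMeasure := by
  have hswap : Measurable (Prod.map Prod.swap Prod.swap : Collision → Collision) := by fun_prop
  refine ⟨hswap, Measure.ext_of_lintegral _ fun F hF => ?_⟩
  rw [lintegral_map hF hswap,
    lintegral_collisionMeasure (F := fun y => F (Prod.map Prod.swap Prod.swap y)) (by fun_prop),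
    lintegral_collisionMeasure hF]
  refine Eq.trans (lintegral_congr fun x => ?_)
    (G.measurePreserving_swap_particles.lintegral_comp (by fun_prop))
  rw [collide_neg, rate_neg]

theorem ae_ae_collide_of_ae_collisionMeasure {Q : Collision → Prop}
    (hQ : ∀ᵐ y ∂G.collisionMeasure, Q y) :
    ∀ᵐ p ∂G.measure, ∀ᵐ z ∂G.partnerMeasure, G.rate p z ≠ 0 → Q (collide G.mass (p, z)) := by
  have hcollide := ae_of_ae_map (measurable_collide G.mass).aemeasurable hQ
  rw [ae_withDensity_iff G.measurable_ofReal_rate] at hcollide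
  filter_upwards [Measure.ae_ae_of_ae_prod hcollide] with p hp
  filter_upwards [hp] with z hz hne
  exact hz (ENNReal.ofReal_pos.2 ((G.rate_nonneg p z).lt_of_ne' hne)).ne'

theorem quasiMeasurePreserving_fst_fst :
    Measure.QuasiMeasurePreserving (fun y : Collision => y.1.1) G.collisionMeasure G.measure := by
  refine ⟨by fun_prop, ?_⟩
  rw [collisionMeasure, Measure.map_map (by fun_prop) (measurable_collide _)]
  exact ((withDensity_absolutelyContinuous _ _).map (f := Prod.fst) measurable_fst).trans
    Measure.quasiMeasurePreserving_fst.absolutelyContinuous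

/-- The collisional balance, as a function of the incoming and outgoing momenta. -/
def balanceOf (ψ : Momentum → ℂ) (y : Collision) : ℂ := ψ y.1.1 + ψ y.1.2 - ψ y.2.1 - ψ y.2.2

theorem balanceOf_collide (ψ : Momentum → ℂ) (p : Momentum) (z : Momentum × Direction) :
    balanceOf ψ (collide G.mass (p, z)) = G.balance ψ p z := rfl

theorem balanceOf_swap (ψ : Momentum → ℂ) (y : Collision) :
    balanceOf ψ y.swap = -balanceOf ψ y := by
  simp only [balanceOf, Prod.fst_swap, Prod.snd_swap]
  ring

theorem balanceOf_map_swap (ψ : Momentum → ℂ) (y : Collision) :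
    balanceOf ψ (Prod.map Prod.swap Prod.swap y) = balanceOf ψ y := by
  simp only [balanceOf, Prod.map_fst, Prod.map_snd, Prod.fst_swap, Prod.snd_swap]
  ring

theorem balanceOf_congr_ae {ψ φ : Momentum → ℂ} (h : ψ =ᵐ[G.measure] φ) :
    balanceOf ψ =ᵐ[G.collisionMeasure] balanceOf φ := by
  have hp := G.quasiMeasurePreserving_fst_fst.ae_eq_comp h
  have hq := G.measurePreserving_map_swap.quasiMeasurePreserving.ae_eq_comp hp
  have hp' := G.measurePreserving_swap.quasiMeasurePreserving.ae_eq_comp hp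
  have hq' := G.measurePreserving_swap.quasiMeasurePreserving.ae_eq_comp hq
  filter_upwards [hp, hq, hp', hq'] with y ep eq ep' eq'
  simp only [Function.comp_apply, Prod.map_fst, Prod.fst_swap] at ep eq ep' eq'
  rw [balanceOf, balanceOf, ep, eq, ep', eq']

theorem rate_mul_balance_congr_ae {ψ φ : Momentum → ℂ}
    (h : balanceOf ψ =ᵐ[G.collisionMeasure] balanceOf φ) :
    ∀ᵐ p ∂G.measure, ∀ᵐ z ∂G.partnerMeasure,
      (G.rate p z : ℂ) * G.balance ψ p z = (G.rate p z : ℂ) * G.balance φ p z := by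
  filter_upwards [G.ae_ae_collide_of_ae_collisionMeasure h] with p hp
  filter_upwards [hp] with z hz
  by_cases h0 : G.rate p z = 0
  · rw [h0, Complex.ofReal_zero, zero_mul, zero_mul]
  · rw [← balanceOf_collide, ← balanceOf_collide, hz h0]

theorem ae_conserved : ∀ᵐ y ∂G.collisionMeasure,
    fourMomentum G.mass y.2.1 + fourMomentum G.mass y.2.2 =
      fourMomentum G.mass y.1.1 + fourMomentum G.mass y.1.2 := by
  rw [collisionMeasure, ae_map_iff (measurable_collide _).aemeasurable
    (measurableSet_eq_fun (by fun_prop) (by fun_prop)),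
    ae_withDensity_iff G.measurable_ofReal_rate]
  refine Eventually.of_forall fun x hx => G.fourMomentum_outgoing_add_of_rate_ne_zero fun h => ?_
  exact hx (by rw [h, ENNReal.ofReal_zero])

@[fun_prop]
theorem measurable_rate :
    Measurable fun x : Momentum × Momentum × Direction => G.rate x.1 x.2 := by
  simpa only [ENNReal.toReal_ofReal (G.rate_nonneg _ _)]
    using G.measurable_ofReal_rate.ennreal_toReal

@[fun_prop]
theorem measurable_balanceOf {ψ : Momentum → ℂ} (hψ : Measurable ψ) :
    Measurable (balanceOf ψ) := by
  unfold balanceOf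
  fun_prop

theorem measurable_rate_mul_balance {ψ : Momentum → ℂ} (hψ : Measurable ψ) :
    Measurable fun x : Momentum × Momentum × Direction =>
      (G.rate x.1 x.2 : ℂ) * G.balance ψ x.1 x.2 := by
  simp only [← balanceOf_collide]
  fun_prop

theorem measurable_rate_mul_balance_right {ψ : Momentum → ℂ} (hψ : Measurable ψ) (p : Momentum) :
    Measurable fun z => (G.rate p z : ℂ) * G.balance ψ p z := by
  have hcomp := (G.measurable_rate_mul_balance hψ).comp (measurable_prodMk_left (x := p))
  exact hcomp

theorem measurable_absCollisionIntegral {ψ : Momentum → ℂ} (hψ : Measurable ψ) :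
    Measurable (G.absCollisionIntegral ψ) :=
  (G.measurable_rate_mul_balance hψ).enorm.lintegral_prod_right'

theorem integrable_collisionMeasure_iff {f : Collision → ℂ} (hf : Measurable f) :
    Integrable f G.collisionMeasure ↔
      Integrable (fun x => (G.rate x.1 x.2 : ℂ) * f (collide G.mass x))
        (G.measure.prod G.partnerMeasure) := by
  rw [collisionMeasure, integrable_map_measure hf.aestronglyMeasurable
    (measurable_collide _).aemeasurable, integrable_withDensity_iff_integrable_smul'
    G.measurable_ofReal_rate (Eventually.of_forall fun _ => ENNReal.ofReal_lt_top)]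
  simp only [ENNReal.toReal_ofReal (G.rate_nonneg _ _), Complex.real_smul, Function.comp_apply]

theorem integral_collisionMeasure {f : Collision → ℂ} (hf : Measurable f)
    (hint : Integrable f G.collisionMeasure) :
    ∫ y, f y ∂G.collisionMeasure =
      ∫ p, ∫ z, (G.rate p z : ℂ) * f (collide G.mass (p, z)) ∂G.partnerMeasure ∂G.measure := by
  rw [← integral_prod _ ((G.integrable_collisionMeasure_iff hf).1 hint), collisionMeasure,
    integral_map (measurable_collide _).aemeasurable hf.aestronglyMeasurable,
    integral_withDensity_eq_integral_toReal_smul G.measurable_ofReal_rate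
      (Eventually.of_forall fun _ => ENNReal.ofReal_lt_top)]
  simp only [ENNReal.toReal_ofReal (G.rate_nonneg _ _), Complex.real_smul]

variable {G}

theorem mem_collisionDomain_iff_memLp {ψ : G.State} :
    ψ ∈ G.collisionDomain ↔ MemLp (G.absCollisionIntegral ψ) 2 G.measure := by
  have hmeas := (G.measurable_absCollisionIntegral
    (Lp.stronglyMeasurable ψ).measurable).aestronglyMeasurable (μ := G.measure)
  rw [MemLp, and_iff_right hmeas,
    eLpNorm_lt_top_iff_lintegral_rpow_enorm_lt_top two_ne_zero ENNReal.ofNat_ne_top]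
  simp [collisionDomain]

theorem lintegral_enorm_mul_absCollisionIntegral_lt_top (χ : G.State) {ψ : G.State}
    (hψ : ψ ∈ G.collisionDomain) :
    ∫⁻ p, ‖χ p‖ₑ * G.absCollisionIntegral ψ p ∂G.measure < ∞ := by
  have hχ := lintegral_rpow_enorm_lt_top_of_eLpNorm_lt_top two_ne_zero ENNReal.ofNat_ne_top
    (Lp.memLp χ).2
  have hI := lintegral_rpow_enorm_lt_top_of_eLpNorm_lt_top two_ne_zero ENNReal.ofNat_ne_top
    (mem_collisionDomain_iff_memLp.1 hψ).2
  refine (ENNReal.lintegral_mul_le_Lp_mul_Lq G.measure Real.HolderConjugate.two_two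
    (Lp.stronglyMeasurable χ).enorm.aemeasurable (G.measurable_absCollisionIntegral
      (Lp.stronglyMeasurable ψ).measurable).aemeasurable).trans_lt (ENNReal.mul_lt_top ?_ ?_)
  · exact ENNReal.rpow_lt_top_of_nonneg (by norm_num) hχ.ne
  · exact ENNReal.rpow_lt_top_of_nonneg (by norm_num) hI.ne

theorem measurable_inner_balanceOf (χ ψ : G.State) :
    Measurable fun y : Collision => inner ℂ (χ y.1.1) (balanceOf ψ y) := by
  have hχ := (Lp.stronglyMeasurable χ).measurable
  have hψ := (Lp.stronglyMeasurable ψ).measurable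
  fun_prop

theorem integrable_inner_balanceOf (χ : G.State) {ψ : G.State} (hψ : ψ ∈ G.collisionDomain) :
    Integrable (fun y => inner ℂ (χ y.1.1) (balanceOf ψ y)) G.collisionMeasure := by
  have hmeas := measurable_inner_balanceOf χ ψ
  rw [G.integrable_collisionMeasure_iff hmeas]
  have hrate : Measurable fun x => (G.rate x.1 x.2 : ℂ) *
      inner ℂ (χ (collide G.mass x).1.1) (balanceOf ψ (collide G.mass x)) := by fun_prop
  refine ⟨hrate.aestronglyMeasurable, ?_⟩
  rw [HasFiniteIntegral, lintegral_prod _ hrate.enorm.aemeasurable]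
  refine lt_of_eq_of_lt (lintegral_congr fun p => ?_)
    (lintegral_enorm_mul_absCollisionIntegral_lt_top χ hψ)
  rw [absCollisionIntegral, ← lintegral_const_mul' _ _ enorm_ne_top]
  refine lintegral_congr fun z => ?_
  rw [balanceOf_collide, RCLike.inner_apply, ← mul_assoc, mul_comm, enorm_mul, RCLike.enorm_conj]
  rfl

theorem inner_eq_integral_inner_balanceOf (χ : G.State) {x : G.State × G.State}
    (hx : x ∈ G.collisionGraph) :
    inner ℂ χ x.2 = ∫ y, inner ℂ (χ y.1.1) (balanceOf x.1 y) ∂G.collisionMeasure := by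
  rw [G.integral_collisionMeasure (measurable_inner_balanceOf χ x.1)
    (integrable_inner_balanceOf χ hx.1), L2.inner_def]
  refine integral_congr_ae ?_
  filter_upwards [hx.2] with p hp
  rw [hp, RCLike.inner_apply, collisionIntegral, ← integral_mul_const]
  exact integral_congr_ae (Eventually.of_forall fun _ => mul_assoc _ _ _)

theorem inner_balanceOf_eq_add (χ ψ : Momentum → ℂ) (y : Collision) :
    inner ℂ (balanceOf χ y) (balanceOf ψ y) =
      inner ℂ (χ y.1.1) (balanceOf ψ y) +
      inner ℂ (χ (Prod.map Prod.swap Prod.swap y).1.1)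
        (balanceOf ψ (Prod.map Prod.swap Prod.swap y)) +
      (inner ℂ (χ y.swap.1.1) (balanceOf ψ y.swap) +
        inner ℂ (χ (Prod.map Prod.swap Prod.swap y).swap.1.1)
          (balanceOf ψ (Prod.map Prod.swap Prod.swap y).swap)) := by
  rw [balanceOf_swap, balanceOf_swap, balanceOf_map_swap]
  simp only [balanceOf, inner_add_left, inner_sub_left, inner_neg_right, Prod.map_fst,
    Prod.map_snd, Prod.fst_swap]
  ring

theorem integral_inner_balanceOf_balanceOf (χ : G.State) {x : G.State × G.State}
    (hx : x ∈ G.collisionGraph) :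
    ∫ y, inner ℂ (balanceOf χ y) (balanceOf x.1 y) ∂G.collisionMeasure = 4 * inner ℂ χ x.2 := by
  set f : Collision → ℂ := fun y => inner ℂ (χ y.1.1) (balanceOf x.1 y)
  have hint : Integrable f G.collisionMeasure := integrable_inner_balanceOf χ hx.1
  have integral_comp {S : Collision → Collision}
      (hS : MeasurePreserving S G.collisionMeasure G.collisionMeasure) :
      ∫ y, f (S y) ∂G.collisionMeasure = inner ℂ χ x.2 := by
    rw [inner_eq_integral_inner_balanceOf χ hx, ← integral_map hS.aemeasurable
      (by rw [hS.map_eq]; exact hint.1), hS.map_eq]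
  have integrable_comp {S : Collision → Collision}
      (hS : MeasurePreserving S G.collisionMeasure G.collisionMeasure) :
      Integrable (fun y => f (S y)) G.collisionMeasure := hS.integrable_comp_of_integrable hint
  have hid := MeasurePreserving.id G.collisionMeasure
  have hswap := G.measurePreserving_swap
  have hmap := G.measurePreserving_map_swap
  calc ∫ y, inner ℂ (balanceOf χ y) (balanceOf x.1 y) ∂G.collisionMeasure
      = ∫ y, (f (id y) + f (Prod.map Prod.swap Prod.swap y)) +
          (f y.swap + f ((Prod.swap ∘ Prod.map Prod.swap Prod.swap) y)) ∂G.collisionMeasure :=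
        integral_congr_ae (Eventually.of_forall fun y => inner_balanceOf_eq_add χ x.1 y)
    _ = inner ℂ χ x.2 + inner ℂ χ x.2 + (inner ℂ χ x.2 + inner ℂ χ x.2) := by
        rw [integral_add, integral_add (integrable_comp hid) (integrable_comp hmap),
          integral_add (integrable_comp hswap) (integrable_comp (hswap.comp hmap)),
          integral_comp hid, integral_comp hmap, integral_comp hswap,
          integral_comp (hswap.comp hmap)]
        · exact (integrable_comp hid).add (integrable_comp hmap)
        · exact (integrable_comp hswap).add (integrable_comp (hswap.comp hmap))
    _ = 4 * inner ℂ χ x.2 := by ring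

theorem absCollisionIntegral_congr_ae {ψ φ : Momentum → ℂ}
    (h : balanceOf ψ =ᵐ[G.collisionMeasure] balanceOf φ) :
    G.absCollisionIntegral ψ =ᵐ[G.measure] G.absCollisionIntegral φ := by
  filter_upwards [G.rate_mul_balance_congr_ae h] with p hp
  exact lintegral_congr_ae (hp.mono fun z hz => congrArg enorm hz)

theorem collisionIntegral_congr_ae {ψ φ : Momentum → ℂ}
    (h : balanceOf ψ =ᵐ[G.collisionMeasure] balanceOf φ) :
    G.collisionIntegral ψ =ᵐ[G.measure] G.collisionIntegral φ := by
  filter_upwards [G.rate_mul_balance_congr_ae h] with p hp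
  exact integral_congr_ae hp

theorem ae_integrable_rate_mul_balance {ψ : G.State} (hψ : ψ ∈ G.collisionDomain) :
    ∀ᵐ p ∂G.measure,
      Integrable (fun z => (G.rate p z : ℂ) * G.balance ψ p z) G.partnerMeasure := by
  have hmeas := (Lp.stronglyMeasurable ψ).measurable
  filter_upwards [ae_lt_top ((G.measurable_absCollisionIntegral hmeas).pow_const 2) hψ.ne]
    with p hp
  exact ⟨(G.measurable_rate_mul_balance_right hmeas p).aestronglyMeasurable,
    (ENNReal.pow_lt_top_iff.1 hp).resolve_right two_ne_zero⟩

theorem mem_collisionGraph_of_balanceOf_eq_zero {ψ : G.State}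
    (h : balanceOf ψ =ᵐ[G.collisionMeasure] 0) : (ψ, 0) ∈ G.collisionGraph := by
  have hzero : balanceOf ψ =ᵐ[G.collisionMeasure] balanceOf 0 := by
    filter_upwards [h] with y hy
    rw [hy]
    simp [balanceOf]
  refine ⟨mem_collisionDomain_iff_memLp.2 ?_, ?_⟩
  · rw [memLp_congr_ae (absCollisionIntegral_congr_ae hzero)]
    have : G.absCollisionIntegral 0 = 0 := by
      funext p
      simp [absCollisionIntegral, balance]
    rw [this]
    exact MemLp.zero
  · filter_upwards [Lp.coeFn_zero ℂ 2 G.measure, collisionIntegral_congr_ae hzero] with p hp hI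
    rw [hp, hI]
    simp [collisionIntegral, balance]

theorem rate_mul_balance_add (ψ φ : Momentum → ℂ) (p : Momentum) (z : Momentum × Direction) :
    (G.rate p z : ℂ) * G.balance (ψ + φ) p z =
      (G.rate p z : ℂ) * G.balance ψ p z + (G.rate p z : ℂ) * G.balance φ p z := by
  simp only [balance, Pi.add_apply]
  ring

theorem rate_mul_balance_smul (c : ℂ) (ψ : Momentum → ℂ) (p : Momentum)
    (z : Momentum × Direction) :
    (G.rate p z : ℂ) * G.balance (c • ψ) p z = c * ((G.rate p z : ℂ) * G.balance ψ p z) := by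
  simp only [balance, Pi.smul_apply, smul_eq_mul]
  ring

theorem absCollisionIntegral_add_le {ψ : Momentum → ℂ} (hψ : Measurable ψ) (φ : Momentum → ℂ)
    (p : Momentum) :
    G.absCollisionIntegral (ψ + φ) p ≤
      G.absCollisionIntegral ψ p + G.absCollisionIntegral φ p := by
  simp only [absCollisionIntegral, rate_mul_balance_add]
  rw [← lintegral_add_left (G.measurable_rate_mul_balance_right hψ p).enorm]
  exact lintegral_mono fun z => enorm_add_le _ _

theorem absCollisionIntegral_smul (c : ℂ) (ψ : Momentum → ℂ) (p : Momentum) :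
    G.absCollisionIntegral (c • ψ) p = ‖c‖ₑ * G.absCollisionIntegral ψ p := by
  simp only [absCollisionIntegral, rate_mul_balance_smul, enorm_mul c]
  exact lintegral_const_mul' _ _ enorm_ne_top

theorem add_mem_collisionGraph {x y : G.State × G.State} (hx : x ∈ G.collisionGraph)
    (hy : y ∈ G.collisionGraph) : x + y ∈ G.collisionGraph := by
  have hB := G.balanceOf_congr_ae (Lp.coeFn_add x.1 y.1)
  have hmeas := (Lp.stronglyMeasurable (x.1 + y.1)).measurable
  refine ⟨mem_collisionDomain_iff_memLp.2 ?_, ?_⟩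
  · refine ((mem_collisionDomain_iff_memLp.1 hx.1).add
      (mem_collisionDomain_iff_memLp.1 hy.1)).of_le_enorm
      (G.measurable_absCollisionIntegral hmeas).aestronglyMeasurable ?_
    filter_upwards [absCollisionIntegral_congr_ae hB] with p hp
    simpa only [Prod.fst_add, hp, Pi.add_apply, enorm_eq_self] using
      absCollisionIntegral_add_le (Lp.stronglyMeasurable x.1).measurable _ p
  · filter_upwards [Lp.coeFn_add x.2 y.2, hx.2, hy.2, collisionIntegral_congr_ae hB,
      ae_integrable_rate_mul_balance hx.1, ae_integrable_rate_mul_balance hy.1]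
      with p hadd hIx hIy hI hintx hinty
    rw [Prod.snd_add, hadd, Pi.add_apply, hIx, hIy, Prod.fst_add, hI]
    simp only [collisionIntegral, rate_mul_balance_add]
    rw [integral_add hintx hinty]

theorem smul_mem_collisionGraph (c : ℂ) {x : G.State × G.State} (hx : x ∈ G.collisionGraph) :
    c • x ∈ G.collisionGraph := by
  have hB := G.balanceOf_congr_ae (Lp.coeFn_smul c x.1)
  refine ⟨?_, ?_⟩
  · have habs : ∀ᵐ p ∂G.measure, G.absCollisionIntegral (c • x).1 p ^ 2 =
        ‖c‖ₑ ^ 2 * G.absCollisionIntegral x.1 p ^ 2 := by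
      filter_upwards [absCollisionIntegral_congr_ae hB] with p hp
      rw [Prod.smul_fst, hp, absCollisionIntegral_smul, mul_pow]
    rw [collisionDomain, Set.mem_ofPred_eq, lintegral_congr_ae habs,
      lintegral_const_mul' _ _ (ENNReal.pow_ne_top enorm_ne_top)]
    exact ENNReal.mul_lt_top (ENNReal.pow_lt_top enorm_lt_top) hx.1
  · filter_upwards [Lp.coeFn_smul c x.2, hx.2, collisionIntegral_congr_ae hB]
      with p hsmul hIx hI
    rw [Prod.smul_snd, hsmul, Pi.smul_apply, hIx, Prod.smul_fst, hI]
    simp only [collisionIntegral, rate_mul_balance_smul]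
    rw [integral_const_mul, smul_eq_mul]

variable (G)

/-- The graph of the linearized collision operator on its natural domain, as a subspace. -/
noncomputable def collisionSubmodule : Submodule ℂ (G.State × G.State) where
  carrier := G.collisionGraph
  zero_mem' := by
    refine mem_collisionGraph_of_balanceOf_eq_zero ?_
    filter_upwards [G.balanceOf_congr_ae (Lp.coeFn_zero ℂ 2 G.measure)] with y hy
    refine hy.trans ?_
    simp [balanceOf]
  add_mem' := add_mem_collisionGraph
  smul_mem' c _ := smul_mem_collisionGraph c

theorem isNonnegSymmetric_collisionSubmodule : IsNonnegSymmetric G.collisionSubmodule where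
  symm x hx y hy := by
    have hxy := integral_inner_balanceOf_balanceOf y.1 hx
    have hyx := congrArg (starRingEnd ℂ) (integral_inner_balanceOf_balanceOf x.1 hy)
    rw [← integral_conj, map_mul, inner_conj_symm, map_ofNat] at hyx
    simp only [inner_conj_symm] at hyx
    exact mul_left_cancel₀ (by norm_num : (4 : ℂ) ≠ 0) (hyx.symm.trans hxy)
  nonneg x hx := by
    have hself := integral_inner_balanceOf_balanceOf x.1 hx
    have hre : ∫ y, ‖balanceOf x.1 y‖ ^ 2 ∂G.collisionMeasure = 4 * (inner ℂ x.1 x.2).re := by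
      rw [← Complex.ofReal_re (∫ y, _ ∂_), ← integral_complex_ofReal, ← Complex.re_ofReal_mul,
        Complex.ofReal_ofNat, ← hself]
      simp only [inner_self_eq_norm_sq_to_K, Complex.coe_algebraMap, Complex.ofReal_pow]
    have : 0 ≤ ∫ y, ‖balanceOf x.1 y‖ ^ 2 ∂G.collisionMeasure :=
      integral_nonneg fun y => sq_nonneg _
    linarith

theorem exists_isSelfAdjointResolvent_collisionOperator :
    ∃ R, IsSelfAdjointResolvent R G.collisionOperator :=
  ⟨_, G.isNonnegSymmetric_collisionSubmodule.isSelfAdjointResolvent_friedrichsResolvent⟩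

variable {G} in
theorem mem_collisionOperator_of_balanceOf_eq_zero {ψ : G.State}
    (h : balanceOf ψ =ᵐ[G.collisionMeasure] 0) : (ψ, 0) ∈ G.collisionOperator :=
  G.isNonnegSymmetric_collisionSubmodule.subset_friedrichsGraph
    (mem_collisionGraph_of_balanceOf_eq_zero h)

end Gas

section Moments

theorem one_add_pow_le_mul_exp {c : ℝ} (hc : 0 < c) (n : ℕ) {r : ℝ} (hr : 0 ≤ r) :
    (1 + r) ^ n ≤ n.factorial * Real.exp c / c ^ n * Real.exp (c * r) := by
  have h := Real.pow_div_factorial_le_exp (c * (1 + r)) (by positivity) n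
  rw [div_le_iff₀ (by positivity), mul_pow, mul_add, mul_one, Real.exp_add] at h
  rw [div_mul_eq_mul_div, le_div_iff₀ (by positivity)]
  linarith

theorem integrable_one_add_norm_pow_mul_exp_neg {E : Type*} [NormedAddCommGroup E]
    [NormedSpace ℝ E] [FiniteDimensional ℝ E] [MeasurableSpace E] [BorelSpace E] (μ : Measure E)
    [μ.IsAddHaarMeasure] {c : ℝ} (hc : 0 < c) (n : ℕ) :
    Integrable (fun x : E => (1 + ‖x‖) ^ n * Real.exp (-(c * ‖x‖))) μ := by
  set d := Module.finrank ℝ E + 1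
  set D : ℝ := (n + d).factorial * Real.exp c / c ^ (n + d)
  have hdecay : Integrable (fun x : E => D * (1 + ‖x‖) ^ (-d : ℝ)) μ :=
    (integrable_one_add_norm (by simp [d])).const_mul D
  refine hdecay.mono' (by fun_prop) (Eventually.of_forall fun x => ?_)
  rw [Real.norm_of_nonneg (by positivity), Real.rpow_neg (by positivity), Real.rpow_natCast,
    ← div_eq_mul_inv, le_div_iff₀ (by positivity), Real.exp_neg, mul_right_comm, ← pow_add,
    ← div_eq_mul_inv, div_le_iff₀ (Real.exp_pos _)]
  exact one_add_pow_le_mul_exp hc (n + d) (norm_nonneg x)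

end Moments

section CollisionInvariants

theorem energy_le {m : ℝ} (hm : 0 ≤ m) (p : Momentum) : energy m p ≤ m + ‖p‖ :=
  Real.sqrt_le_iff.2 ⟨by positivity, by nlinarith [norm_nonneg p]⟩

theorem abs_fourMomentum_le (m : ℝ) (p : Momentum) (μ : Fin 4) :
    |fourMomentum m p μ| ≤ energy m p := by
  cases μ using Fin.cases with
  | zero => simp [fourMomentum, abs_of_nonneg (energy_nonneg m p)]
  | succ j => exact (PiLp.norm_apply_le p j).trans (norm_le_energy m p)

namespace Gas

variable (G : Gas)

theorem feq_le (p : Momentum) :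
    G.feq p ≤ Real.exp G.α * Real.exp (-((G.β₀ - ‖G.β‖) * ‖p‖)) := by
  have hβ₀ : 0 ≤ G.β₀ := (norm_nonneg _).trans G.β_timelike.le
  have hexponent : minkowski (Fin.cons G.β₀ fun j => G.β j) (fourMomentum G.mass p) =
      -(G.β₀ * energy G.mass p) + inner ℝ G.β p := by
    simp [minkowski, fourMomentum, PiLp.inner_apply, mul_comm]
  rw [feq, ← Real.exp_add, Real.exp_le_exp, hexponent]
  linarith [real_inner_le_norm G.β p, mul_le_mul_of_nonneg_left (norm_le_energy G.mass p) hβ₀]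

theorem integrable_one_add_norm_pow (n : ℕ) :
    Integrable (fun p => (1 + ‖p‖) ^ n) G.measure := by
  rw [measure, integrable_withDensity_iff_integrable_smul' (by fun_prop)
    (Eventually.of_forall fun _ => ENNReal.ofReal_lt_top)]
  refine ((integrable_one_add_norm_pow_mul_exp_neg volume (sub_pos.2 G.β_timelike) n).const_mul
    (Real.exp G.α / (2 * Real.pi) ^ 3)).mono' ?_ (Eventually.of_forall fun p => ?_)
  · exact Measurable.aestronglyMeasurable (by fun_prop)
  · have hpos := G.feq_pos p
    rw [ENNReal.toReal_ofReal (by positivity), smul_eq_mul, Real.norm_of_nonneg (by positivity)]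
    calc G.feq p / (2 * Real.pi) ^ 3 * (1 + ‖p‖) ^ n
        ≤ Real.exp G.α * Real.exp (-((G.β₀ - ‖G.β‖) * ‖p‖)) / (2 * Real.pi) ^ 3 *
          (1 + ‖p‖) ^ n := by gcongr; exact G.feq_le p
      _ = _ := by ring

theorem memLp_two_of_abs_le_one_add_norm_pow {h : Momentum → ℝ} (hmeas : Measurable h) {C : ℝ}
    {n : ℕ} (hle : ∀ p, |h p| ≤ C * (1 + ‖p‖) ^ n) :
    MemLp (fun p => (h p : ℂ)) 2 G.measure := by
  have hpow : MemLp (fun p => (1 + ‖p‖) ^ n) 2 G.measure := by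
    rw [memLp_two_iff_integrable_sq (by fun_prop)]
    simpa only [← pow_mul] using G.integrable_one_add_norm_pow (n * 2)
  refine hpow.of_le_mul (by fun_prop) (Eventually.of_forall fun p => ?_) (c := C)
  rw [Complex.norm_real, Real.norm_eq_abs, Real.norm_of_nonneg (by positivity)]
  exact hle p

/-- The collision invariants `1` and `p^ν`, the former being indexed by `none`. -/
noncomputable def invariant (i : Option (Fin 4)) (p : Momentum) : ℝ :=
  i.elim 1 fun ν => fourMomentum G.mass p ν

@[fun_prop]
theorem measurable_invariant (i : Option (Fin 4)) : Measurable (G.invariant i) := by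
  cases i with
  | none => exact measurable_const
  | some ν => exact (measurable_pi_apply ν).comp (measurable_fourMomentum G.mass)

theorem abs_invariant_le (i : Option (Fin 4)) (p : Momentum) :
    |G.invariant i p| ≤ (1 + G.mass) * (1 + ‖p‖) := by
  have hm := G.mass_nonneg
  have hmp : 0 ≤ G.mass * ‖p‖ := by positivity
  cases i with
  | none => simp only [invariant, Option.elim, abs_one]; linarith [norm_nonneg p]
  | some ν =>
    simp only [invariant, Option.elim]
    linarith [abs_fourMomentum_le G.mass p ν, energy_le hm p]

theorem memLp_invariant (i : Option (Fin 4)) :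
    MemLp (fun p => (G.invariant i p : ℂ)) 2 G.measure :=
  G.memLp_two_of_abs_le_one_add_norm_pow (n := 1) (G.measurable_invariant i) fun p => by
    simpa only [pow_one] using G.abs_invariant_le i p

/-- The collision invariants, as states. -/
noncomputable def invariantState (i : Option (Fin 4)) : G.State := (G.memLp_invariant i).toLp

theorem coeFn_invariantState (i : Option (Fin 4)) :
    G.invariantState i =ᵐ[G.measure] fun p => (G.invariant i p : ℂ) := MemLp.coeFn_toLp _

theorem inner_invariantState (i : Option (Fin 4)) (ψ : G.State) :
    inner ℂ (G.invariantState i) ψ = ∫ p, (G.invariant i p : ℂ) * ψ p ∂G.measure := by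
  rw [L2.inner_def]
  refine integral_congr_ae ?_
  filter_upwards [G.coeFn_invariantState i] with p hp
  rw [hp, RCLike.inner_apply, Complex.conj_ofReal, mul_comm]

theorem invariantState_mem_collisionOperator (i : Option (Fin 4)) :
    (G.invariantState i, 0) ∈ G.collisionOperator := by
  refine mem_collisionOperator_of_balanceOf_eq_zero ?_
  filter_upwards [G.balanceOf_congr_ae (G.coeFn_invariantState i), G.ae_conserved] with y hy hcons
  rw [hy, Pi.zero_apply]
  simp only [balanceOf, ← Complex.ofReal_add, ← Complex.ofReal_sub]
  rw [Complex.ofReal_eq_zero]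
  cases i with
  | none => simp [invariant]
  | some ν =>
    have hν := congrFun hcons ν
    simp only [Pi.add_apply] at hν
    simp only [invariant, Option.elim]
    linarith

/-- The hydrodynamic subspace: the span of the collision invariants. -/
noncomputable def invariants : Submodule ℂ G.State :=
  Submodule.span ℂ (Set.range G.invariantState)

instance : FiniteDimensional ℂ G.invariants :=
  FiniteDimensional.span_of_finite ℂ (Set.finite_range _)

theorem mem_collisionOperator_of_mem_invariants {ν : G.State} (hν : ν ∈ G.invariants) :
    (ν, 0) ∈ G.collisionOperator := by
  obtain ⟨R, hR⟩ := G.exists_isSelfAdjointResolvent_collisionOperator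
  have hfix (φ : G.State) : (φ, 0) ∈ G.collisionOperator ↔
      φ ∈ LinearMap.eqLocus LinearMap.id (R : G.State →ₗ[ℂ] G.State) := by
    simp [hR.mem_iff]
  rw [hfix]
  refine Submodule.span_le.2 ?_ hν
  rintro _ ⟨i, rfl⟩
  exact (hfix _).1 (G.invariantState_mem_collisionOperator i)

theorem mem_orthogonal_invariants_iff (ψ : G.State) :
    ψ ∈ G.invariantsᗮ ↔ ∀ i, ∫ p, (G.invariant i p : ℂ) * ψ p ∂G.measure = 0 := by
  simp only [← inner_invariantState]
  refine ⟨fun h i => h _ (Submodule.subset_span ⟨i, rfl⟩), fun h => ?_⟩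
  have hle : G.invariants ≤ (ℂ ∙ ψ)ᗮ := by
    refine Submodule.span_le.2 ?_
    rintro _ ⟨i, rfl⟩
    exact Submodule.mem_orthogonal_singleton_iff_inner_left.2 (h i)
  exact fun φ hφ => Submodule.mem_orthogonal_singleton_iff_inner_left.1 (hle hφ)

end Gas

end CollisionInvariants

section MultiplicationOperator

variable {X : Type*} [MeasurableSpace X] {μ : Measure X} {g h : X → ℝ}

/-- Multiplication by an essentially bounded real function, on the complex space `L²`. -/
noncomputable def mulOperator (hg : MemLp g ∞ μ) : Lp ℂ 2 μ →L[ℂ] Lp ℂ 2 μ :=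
  (ContinuousLinearMap.mul ℂ ℂ).holderL μ ∞ 2 2 (hg.ofReal (K := ℂ)).toLp

theorem coeFn_mulOperator (hg : MemLp g ∞ μ) (ψ : Lp ℂ 2 μ) :
    mulOperator hg ψ =ᵐ[μ] fun x => (g x : ℂ) * ψ x := by
  filter_upwards [ContinuousLinearMap.coeFn_holder (r := 2) (ContinuousLinearMap.mul ℂ ℂ)
    (hg.ofReal (K := ℂ)).toLp ψ, (hg.ofReal (K := ℂ)).coeFn_toLp] with x hmul hgx
  exact hmul.trans (congrArg (· * ψ x) hgx)

theorem mulOperator_const (c : ℝ) : mulOperator (memLp_top_const (μ := μ) c) = c • 1 := by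
  ext ψ
  filter_upwards [coeFn_mulOperator (memLp_top_const (μ := μ) c) ψ, Lp.coeFn_smul c ψ] with x hx hc
  rw [hx]
  exact hc.symm

theorem mulOperator_mono (hg : MemLp g ∞ μ) (hh : MemLp h ∞ μ) (hle : g ≤ᵐ[μ] h) :
    mulOperator hg ≤ mulOperator hh := by
  rw [ContinuousLinearMap.le_def, ContinuousLinearMap.isPositive_iff_complex]
  intro ψ
  have hinner : inner ℂ ((mulOperator hh - mulOperator hg) ψ) ψ =
      ((∫ x, (h x - g x) * ‖ψ x‖ ^ 2 ∂μ : ℝ) : ℂ) := by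
    rw [L2.inner_def, ← integral_complex_ofReal]
    refine integral_congr_ae ?_
    filter_upwards [Lp.coeFn_sub (mulOperator hh ψ) (mulOperator hg ψ), coeFn_mulOperator hh ψ,
      coeFn_mulOperator hg ψ] with x hsub hhx hgx
    rw [sub_apply, hsub, Pi.sub_apply, hhx, hgx, ← sub_mul,
      ← Complex.ofReal_sub, RCLike.inner_apply, map_mul, Complex.conj_ofReal, mul_left_comm,
      Complex.mul_conj']
    push_cast
    rfl
  rw [hinner]
  refine ⟨by simp, ?_⟩
  simp only [RCLike.re_to_complex, Complex.ofReal_re]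
  refine integral_nonneg_of_ae ?_
  filter_upwards [hle] with x hx
  exact mul_nonneg (sub_nonneg.2 hx) (sq_nonneg _)

end MultiplicationOperator

section LorentzFactor

variable {v : ℝ}

theorem lorentzFactor_nonneg (v : ℝ) : 0 ≤ lorentzFactor v :=
  one_div_nonneg.2 (Real.sqrt_nonneg _)

theorem lorentzFactor_pos (h0 : 0 ≤ v) (h1 : v < 1) : 0 < lorentzFactor v :=
  one_div_pos.2 (Real.sqrt_pos.2 (by nlinarith))

end LorentzFactor

section Observer

theorem minkowski_fourVelocity_div_energy (m : ℝ) (V : Momentum) {p : Momentum} (hp : p ≠ 0) :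
    minkowski (fourVelocity V) (fourMomentum m p) / energy m p =
      -(lorentzFactor ‖V‖ * (1 - ∑ j : Fin 3, p j / energy m p * V j)) := by
  have hpos := (energy_pos m hp).ne'
  simp only [minkowski, fourVelocity, fourMomentum, Fin.cons_zero, Fin.cons_succ,
    Fin.sum_univ_three]
  field_simp
  ring

namespace Gas

theorem contract_ofReal_mul (u a : Fin 4 → ℝ) (c : ℂ) :
    contract u (fun μ => (a μ : ℂ) * c) = (minkowski u a : ℂ) * c := by
  simp only [contract, minkowski, Fin.sum_univ_three]
  push_cast
  ring

theorem contract_integral {X : Type*} [MeasurableSpace X] {μ : Measure X} (u : Fin 4 → ℝ)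
    {A : Fin 4 → X → ℂ} (hA : ∀ ν, Integrable (A ν) μ) :
    contract u (fun ν => ∫ x, A ν x ∂μ) = ∫ x, contract u (fun ν => A ν x) ∂μ := by
  have hmul (ν : Fin 4) : Integrable (fun x => (u ν : ℂ) * A ν x) μ := (hA ν).const_mul _
  simp only [contract]
  rw [integral_add (f := fun x => -((u 0 : ℂ) * A 0 x)) (hmul 0).neg
    (integrable_finsetSum _ fun j _ => hmul j.succ), integral_neg,
    integral_finsetSum _ fun j _ => hmul j.succ]
  simp only [integral_const_mul]

variable (G : Gas)

/-- The rate `-u_μ p^μ / p⁰` of the proper time of the observer of velocity `V` along a particle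
of momentum `p`, in the form `γ (1 - V · w)`, which is not a junk value at `p⁰ = 0`. -/
noncomputable def observerRate (V p : Momentum) : ℝ :=
  lorentzFactor ‖V‖ * (1 - ∑ j : Fin 3, G.velocity j p * V j)

@[fun_prop]
theorem measurable_observerRate (V : Momentum) : Measurable (G.observerRate V) := by
  unfold observerRate velocity
  fun_prop

theorem abs_sum_velocity_mul_le (V p : Momentum) :
    |∑ j : Fin 3, G.velocity j p * V j| ≤ ‖V‖ := by
  have hinner : ∑ j : Fin 3, G.velocity j p * V j = inner ℝ V p / energy G.mass p := by
    simp only [PiLp.inner_apply, velocity, Fin.sum_univ_three, RCLike.inner_apply, conj_trivial]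
    ring
  rw [hinner, abs_div, abs_of_nonneg (energy_nonneg G.mass p)]
  refine div_le_of_le_mul₀ (energy_nonneg G.mass p) (norm_nonneg V) ?_
  exact (abs_real_inner_le_norm V p).trans (by gcongr; exact norm_le_energy G.mass p)

theorem le_observerRate (V p : Momentum) :
    lorentzFactor ‖V‖ * (1 - ‖V‖) ≤ G.observerRate V p :=
  mul_le_mul_of_nonneg_left (by linarith [(abs_le.1 (G.abs_sum_velocity_mul_le V p)).2])
    (lorentzFactor_nonneg _)

theorem abs_observerRate_le (V p : Momentum) :
    |G.observerRate V p| ≤ lorentzFactor ‖V‖ * (1 + ‖V‖) := by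
  rw [observerRate, abs_mul, abs_of_nonneg (lorentzFactor_nonneg _)]
  have := abs_le.1 (G.abs_sum_velocity_mul_le V p)
  exact mul_le_mul_of_nonneg_left (abs_le.2 ⟨by linarith, by linarith⟩) (lorentzFactor_nonneg _)

theorem memLp_top_observerRate (V : Momentum) : MemLp (G.observerRate V) ∞ G.measure :=
  memLp_top_of_bound (by fun_prop) (lorentzFactor ‖V‖ * (1 + ‖V‖))
    (Eventually.of_forall (G.abs_observerRate_le V))

/-- Multiplication by `-u_μ p^μ / p⁰`, the coefficient of `iω` in the eigenmode equation at zero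
wavenumber relative to the observer of velocity `V`. -/
noncomputable def observerMultiplier (V : Momentum) : G.State →L[ℂ] G.State :=
  mulOperator (G.memLp_top_observerRate V)

theorem coeFn_observerMultiplier (V : Momentum) (ψ : G.State) :
    G.observerMultiplier V ψ =ᵐ[G.measure] fun p => (G.observerRate V p : ℂ) * ψ p :=
  coeFn_mulOperator _ ψ

theorem smul_one_le_observerMultiplier (V : Momentum) :
    (lorentzFactor ‖V‖ * (1 - ‖V‖)) • 1 ≤ G.observerMultiplier V := by
  rw [← mulOperator_const]
  exact mulOperator_mono _ _ (Eventually.of_forall (G.le_observerRate V))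

theorem observerMultiplier_le_smul_one (V : Momentum) :
    G.observerMultiplier V ≤ (lorentzFactor ‖V‖ * (1 + ‖V‖)) • 1 := by
  rw [← mulOperator_const]
  exact mulOperator_mono _ _ (Eventually.of_forall fun p =>
    (le_abs_self _).trans (G.abs_observerRate_le V p))

theorem observerMultiplier_zero : G.observerMultiplier 0 = 1 := by
  refine le_antisymm ?_ ?_
  · simpa [lorentzFactor] using G.observerMultiplier_le_smul_one 0
  · simpa [lorentzFactor] using G.smul_one_le_observerMultiplier 0

theorem ae_ne_zero : ∀ᵐ p ∂G.measure, p ≠ 0 :=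
  (withDensity_absolutelyContinuous _ _).ae_le (Measure.ae_ne volume 0)

theorem integrable_invariant_mul (i : Option (Fin 4)) (ψ : G.State) :
    Integrable (fun p => (G.invariant i p : ℂ) * ψ p) G.measure :=
  (G.memLp_invariant i).integrable_mul (Lp.memLp ψ)

theorem integrable_flux {F : Momentum → ℂ} (hF : Integrable F G.measure) (μ : Fin 4) :
    Integrable (fun p => ((fourMomentum G.mass p μ / energy G.mass p : ℝ) : ℂ) * F p)
      G.measure := by
  refine hF.bdd_mul (c := 1) (Measurable.aestronglyMeasurable (by fun_prop))
    (Eventually.of_forall fun p => ?_)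
  rw [Complex.norm_real, Real.norm_eq_abs, abs_div, abs_of_nonneg (energy_nonneg G.mass p)]
  exact div_le_one_of_le₀ (abs_fourMomentum_le G.mass p μ) (energy_nonneg G.mass p)

theorem integral_observerRate_mul {F : Momentum → ℂ} (hF : Integrable F G.measure)
    (V : Momentum) : ∫ p, (G.observerRate V p : ℂ) * F p ∂G.measure =
      -contract (fourVelocity V) fun μ =>
        ∫ p, ((fourMomentum G.mass p μ / energy G.mass p : ℝ) : ℂ) * F p ∂G.measure := by
  rw [contract_integral _ (G.integrable_flux hF), ← integral_neg]
  refine integral_congr_ae ?_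
  filter_upwards [G.ae_ne_zero] with p hp
  have hrate : minkowski (fourVelocity V) (fun μ => fourMomentum G.mass p μ / energy G.mass p) =
      -G.observerRate V p := by
    rw [observerRate]
    simp only [velocity]
    rw [← minkowski_fourVelocity_div_energy G.mass V hp]
    simp only [minkowski, Fin.sum_univ_three]
    ring
  rw [contract_ofReal_mul, hrate, Complex.ofReal_neg, neg_mul, neg_neg]

theorem noConservedDensity_iff (V : Momentum) (ψ : G.State) :
    G.NoConservedDensity (fourVelocity V) ψ ↔ G.observerMultiplier V ψ ∈ G.invariantsᗮ := by
  have hinner (i : Option (Fin 4)) :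
      ∫ p, (G.invariant i p : ℂ) * G.observerMultiplier V ψ p ∂G.measure =
        -contract (fourVelocity V) fun μ => ∫ p, ((fourMomentum G.mass p μ / energy G.mass p *
          G.invariant i p : ℝ) : ℂ) * ψ p ∂G.measure := by
    simp only [Complex.ofReal_mul, mul_assoc]
    rw [← G.integral_observerRate_mul (G.integrable_invariant_mul i ψ)]
    refine integral_congr_ae ?_
    filter_upwards [G.coeFn_observerMultiplier V ψ] with p hp
    rw [hp, mul_left_comm]
  simp only [mem_orthogonal_invariants_iff, hinner, neg_eq_zero]
  simp only [Option.forall, invariant, Option.elim, mul_one]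
  rfl

theorem isEigenSequence_iff (V : Momentum) (ω : ℂ) (x : ℕ → G.State × G.State) :
    G.IsEigenSequence (fun μ => ω * (fourVelocity V μ : ℂ)) x ↔
      (∀ n, x n ∈ G.collisionOperator) ∧ (∀ n, ‖(x n).1‖ = 1) ∧
        Tendsto (fun n => (x n).2 - (Complex.I * ω) • G.observerMultiplier V (x n).1) atTop
          (𝓝 0) := by
  rw [IsEigenSequence, tendsto_zero_iff_enorm_tendsto_zero]
  simp only [Lp.enorm_def]
  refine and_congr_right' (and_congr_right' (tendsto_congr fun n => eLpNorm_congr_ae ?_))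
  filter_upwards [Lp.coeFn_sub (x n).2 ((Complex.I * ω) • G.observerMultiplier V (x n).1),
    Lp.coeFn_smul (Complex.I * ω) (G.observerMultiplier V (x n).1),
    G.coeFn_observerMultiplier V (x n).1] with p hsub hsmul hmul
  rw [hsub, Pi.sub_apply, hsmul, Pi.smul_apply, hmul, smul_eq_mul]
  simp only [observerRate, fourVelocity, Fin.cons_zero, Fin.cons_succ, Fin.sum_univ_three]
  push_cast
  ring

theorem mem_nonhydroSpectrum_iff (V : Momentum) (ω : ℂ) : ω ∈ G.nonhydroSpectrum V ↔
    Complex.I * ω ∈ pencilSpectrum G.collisionOperator (G.observerMultiplier V) G.invariants := by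
  refine exists_congr fun x => ?_
  rw [G.isEigenSequence_iff]
  simp only [G.noConservedDensity_iff]
  tauto

end Gas

end Observer

section Confinement

theorem Confined.mono {S : Set ℂ} {a a' : ℝ} {b : EReal} (h : Confined S a b) (ha : a' ≤ a) :
    Confined S a' b := fun ω hω =>
  (h ω hω).imp fun _ hr => ⟨hr.1, ha.trans hr.2.1, hr.2.2⟩

theorem mul_one_sub_div_lorentzFactor_le {v : ℝ} (h0 : 0 ≤ v) (h1 : v < 1) {a : ℝ} (ha : 0 ≤ a) :
    a * (1 - v) / lorentzFactor v ≤ a / (lorentzFactor v * (1 + v)) := by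
  have hγ := lorentzFactor_pos h0 h1
  rw [div_le_div_iff₀ hγ (by positivity)]
  calc a * (1 - v) * (lorentzFactor v * (1 + v)) = a * lorentzFactor v * (1 - v ^ 2) := by ring
    _ ≤ a * lorentzFactor v :=
      mul_le_of_le_one_right (by positivity) (sub_le_self 1 (sq_nonneg v))

end Confinement

end Kinetic

theorem theorem1_general (G : Kinetic.Gas) (V : Kinetic.Momentum) (hV : ‖V‖ < 1) (a : ℝ)
    (ha : 0 ≤ a) (b : EReal) (hspec : Kinetic.Confined (G.nonhydroSpectrum 0) a b) :
    Kinetic.Confined (G.nonhydroSpectrum V)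
      (a / (Kinetic.lorentzFactor ‖V‖ * (1 + ‖V‖)))
      (b / ((Kinetic.lorentzFactor ‖V‖ * (1 - ‖V‖) : ℝ) : EReal)) := by
  obtain ⟨R, hR⟩ := G.exists_isSelfAdjointResolvent_collisionOperator
  have hpos : 0 < Kinetic.lorentzFactor ‖V‖ * (1 - ‖V‖) :=
    mul_pos (Kinetic.lorentzFactor_pos (norm_nonneg V) hV) (sub_pos.2 hV)
  have hrest (r : ℝ)
      (hr : (r : ℂ) ∈ Kinetic.pencilSpectrum G.collisionOperator 1 G.invariants) :
      a ≤ r ∧ (r : EReal) ≤ b := by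
    have hmem : -Complex.I * r ∈ G.nonhydroSpectrum 0 := by
      rw [G.mem_nonhydroSpectrum_iff, G.observerMultiplier_zero]
      simpa [← mul_assoc] using hr
    obtain ⟨s, hs, has, hsb⟩ := hspec _ hmem
    obtain rfl : r = s := by simpa [← mul_assoc] using hs
    exact ⟨has, hsb⟩
  intro ω hω
  exact hR.confined_pencilSpectrum (fun _ => G.mem_collisionOperator_of_mem_invariants) hpos
    (G.smul_one_le_observerMultiplier V) (G.observerMultiplier_le_smul_one V) ha hrest
    ((G.mem_nonhydroSpectrum_iff V ω).1 hω)

theorem theorem1 (G : Kinetic.Gas) (hdense : Dense G.collisionDomain)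
    (V : Kinetic.Momentum) (hV : ‖V‖ < 1) (a : ℝ) (ha : 0 ≤ a) (b : EReal)
    (hspec : Kinetic.Confined (G.nonhydroSpectrum 0) a b) :
    Kinetic.Confined (G.nonhydroSpectrum V)
      (a * (1 - ‖V‖) / Kinetic.lorentzFactor ‖V‖)
      (b / ((Kinetic.lorentzFactor ‖V‖ * (1 - ‖V‖) : ℝ) : EReal)) :=
  (theorem1_general G V hV a ha b hspec).mono
    (Kinetic.mul_one_sub_div_lorentzFactor_le (norm_nonneg V) hV ha)
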